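/- **Setting.** Let $n\ge 2$, $q_{11},\dots,q_{nn}>0$, $Q=\prod_{j=1}^n]0,q_{jj}[$, $\tilde Q=\prod_{j=1}^n]-q_{jj}/2,q_{jj}/2[$, let $q$ be the diagonal matrix with entries $q_{jj}$, and let $\mathbb K$ be $\mathbb R$ or $\mathbb C$. All functions below have values in $\mathbb K$. For $\Omega$ with $\operatorname{cl}\Omega\subseteq Q$ put $\mathbb S[\Omega]=\bigcup_{z\in\mathbb Z^n}(qz+\Omega)$ and $\mathbb S[\Omega]^-=\mathbb R^n\setminus\operatorname{cl}\mathbb S[\Omega]$. For an open set $U$, $C^\infty(\operatorname{cl}U)$ is the space of the $C^\infty$ functions on $U$ all of whose derivatives extend continuously to $\operatorname{cl}U$. Let $\rho>0$. * For a bounded open set $\Omega$, $C^0_{\omega,\rho}(\operatorname{cl}\Omega)$ is the space of the $u\in C^\infty(\operatorname{cl}\Omega)$ with $\|u\|=\sup_{\beta\in\mathbb N^n}\frac{\rho^{|\beta|}}{|\beta|!}\sup_{\operatorname{cl}\Omega}|D^\beta u|<\infty$. * $C^0_{q,\omega,\rho}(\operatorname{cl}\mathbb S[\Omega])$ and $C^0_{q,\omega,\rho}(\operatorname{cl}\mathbb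 S[\Omega]^-)$ are the spaces of the $q$-periodic functions $u$ in $C^\infty(\operatorname{cl}\mathbb S[\Omega])$, respectively in $C^\infty(\operatorname{cl}\mathbb S[\Omega]^-)$, for which $\sup_{\beta}\frac{\rho^{|\beta|}}{|\beta|!}\sup_{K}|D^\beta u|$ is finite, where $K=\operatorname{cl}\Omega$, respectively $K=\operatorname{cl}Q\setminus\Omega$ (here $\Omega$ is open, and Lipschitz in the second case); this number is the norm. * For $\lambda>0$ and a $q$-periodic continuous $h$ on $\mathbb R^n\setminus q\mathbb Z^n$ let $\|h\|_{A^0_{q,\lambda}}=\sup_{x\in\tilde Q\setminus\{0\}}|h(x)|\,|x|^\lambda$. Let $A^1_{q,\lambda}$ be the space of the $q$-periodic $h\in C^1(\mathbb R^n\setminus q\mathbb Z^n)$ with $\|h\|_{A^1_{q,\lambda}}=\|h\|_{A^0_{q,\lambda}}+\sum_{j=1}^n\|\partial_{x_j}h\|_{A^0_{q,\lambda+1}}<\infty$. * For a bounded open set $G$ with $\operatorname{cl}G\cap q\mathbb Z^n=\emptyset$ let $H_q^{\lambda,\rho}(G)=\{h\in A^1_{q,\lambda}:h_{|\operatorname{cl}G}\in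 C^0_{\omega,\rho}(\operatorname{cl}G)\}$, normed by $\|h\|_{A^1_{q,\lambda}}+\|h\|_{C^0_{\omega,\rho}(\operatorname{cl}G)}$. * $\mathcal P^+[h,\varphi](x)=\int_\Omega h(x-y)\varphi(y)\,dy$ and $\mathcal P^-[h,\varphi](x)=\int_{Q\setminus\operatorname{cl}\Omega}h(x-y)\varphi(y)\,dy$ for $x\in\mathbb R^n$. **Theorem 3.8.** Let $\rho>0$ and $\lambda\in\,]0,n-1[$. Let $\Omega$ be a bounded open Lipschitz subset of $\mathbb R^n$ with $\operatorname{cl}\Omega\subseteq Q$, and let $\Omega_1$ be a nonempty open subset of $\mathbb R^n$ with $\operatorname{cl}\Omega_1\subseteq\Omega$. Let $G$ be an open relatively compact neighbourhood of $\{t-s:t\in\operatorname{cl}\Omega_1,\ s\in\partial\Omega\}$ such that $\operatorname{cl}G\cap q\mathbb Z^n=\emptyset$. Then the following statements hold. (i) For all $(h,\varphi)\in H_q^{\lambda,\rho}(G)\times C^0_{\omega,\rho}(\operatorname{cl}\Omega)$ the integral defining $\mathcal P^+[h,\varphi](x)$ converges absolutely for every $x\in\mathbb R^n$, and the restriction of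 $\mathcal P^+[h,\varphi]$ to $\operatorname{cl}\mathbb S[\Omega_1]$ belongs to $C^0_{q,\omega,\rho}(\operatorname{cl}\mathbb S[\Omega_1])$. The map $(h,\varphi)\mapsto\mathcal P^+[h,\varphi]_{|\operatorname{cl}\mathbb S[\Omega_1]}$ from $H_q^{\lambda,\rho}(G)\times C^0_{\omega,\rho}(\operatorname{cl}\Omega)$ to $C^0_{q,\omega,\rho}(\operatorname{cl}\mathbb S[\Omega_1])$ is bilinear and continuous. (ii) For all $(h,\varphi)\in H_q^{\lambda,\rho}(G)\times C^0_{q,\omega,\rho}(\operatorname{cl}\mathbb S[\Omega]^-)$ the integral defining $\mathcal P^-[h,\varphi_{|Q\setminus\operatorname{cl}\Omega}](x)$ converges absolutely for every $x\in\mathbb R^n$, and the restriction of $\mathcal P^-[h,\varphi_{|Q\setminus\operatorname{cl}\Omega}]$ to $\operatorname{cl}\mathbb S[\Omega_1]$ belongs to $C^0_{q,\omega,\rho}(\operatorname{cl}\mathbb S[\Omega_1])$. The map $(h,\varphi)\mapsto\mathcal P^-[h,\varphi_{|Q\setminus\operatorname{cl}\Omega}]_{|\operatorname{cl}\mathbb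 S[\Omega_1]}$ from $H_q^{\lambda,\rho}(G)\times C^0_{q,\omega,\rho}(\operatorname{cl}\mathbb S[\Omega]^-)$ to $C^0_{q,\omega,\rho}(\operatorname{cl}\mathbb S[\Omega_1])$ is bilinear and continuous. -/

import Mathlib

open Set Filter Topology MeasureTheory
open scoped ENNReal NNReal ContDiff

noncomputable section

namespace PeriodicPotential

/-- `ℝⁿ` with the Euclidean norm. -/
abbrev Euc (n : ℕ) : Type := EuclideanSpace ℝ (Fin n)

section Geometry

variable {n : ℕ}

/-- The lattice point `q z = (q₁₁ z₁, …, qₙₙ zₙ)`, where `q` is the list of the diagonal entries. -/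
def latPt (q : Fin n → ℝ) (z : Fin n → ℤ) : Euc n := WithLp.toLp 2 (fun j => q j * (z j : ℝ))

/-- The lattice `q ℤⁿ`. -/
def lattice (q : Fin n → ℝ) : Set (Euc n) := Set.range (latPt q)

/-- The open periodicity cell `Q = ∏ ]0, q_jj[`. -/
def cell (q : Fin n → ℝ) : Set (Euc n) := {x | ∀ j, 0 < x j ∧ x j < q j}

/-- The open centered cell `Q̃ = ∏ ]-q_jj/2, q_jj/2[`. -/
def centeredCell (q : Fin n → ℝ) : Set (Euc n) := {x | ∀ j, -(q j / 2) < x j ∧ x j < q j / 2}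

/-- The periodic set `𝕊[Ω] = ⋃_z (q z + Ω)`. -/
def perSet (q : Fin n → ℝ) (Ω : Set (Euc n)) : Set (Euc n) :=
  ⋃ z : Fin n → ℤ, (fun x => latPt q z + x) '' Ω

/-- The exterior periodic set `𝕊[Ω]⁻ = ℝⁿ \ cl 𝕊[Ω]`. -/
def perSetExt (q : Fin n → ℝ) (Ω : Set (Euc n)) : Set (Euc n) := (closure (perSet q Ω))ᶜ

/-- Bounded open Lipschitz subsets of `ℝⁿ` (not necessarily connected): near each boundary point,
and after a suitable choice of an orthogonal splitting `ℝⁿ = ν^⊥ ⊕ ℝ ν`, the set is the part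
lying strictly above the graph of a Lipschitz function of the variables in `ν^⊥`. -/
structure IsBoundedLipschitz (Ω : Set (Euc n)) : Prop where
  isOpen : IsOpen Ω
  isBounded : Bornology.IsBounded Ω
  graph : ∀ x ∈ frontier Ω, ∃ (ν : Euc n) (γ : (Submodule.span ℝ {ν})ᗮ → ℝ) (K : ℝ≥0) (r : ℝ),
    ‖ν‖ = 1 ∧ LipschitzWith K γ ∧ 0 < r ∧
      ∀ y ∈ Metric.ball x r,
        (y ∈ Ω ↔ γ ((Submodule.span ℝ {ν})ᗮ.orthogonalProjectionOnto y) < inner ℝ ν y)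

end Geometry

section Derivatives

variable {𝕜 : Type*} [RCLike 𝕜] {n : ℕ}

/-- The partial derivative `∂ f / ∂ x_j`. -/
def partialD (j : Fin n) (f : Euc n → 𝕜) : Euc n → 𝕜 :=
  fun x => fderiv ℝ f x (EuclideanSpace.single j 1)

/-- The list of indices `0, …, 0, 1, …, 1, …` in which each `j` occurs `β j` times. -/
def multiList (β : Fin n → ℕ) : List (Fin n) :=
  (List.finRange n).flatMap (fun j => List.replicate (β j) j)

/-- The iterated partial derivative `D^β f`. -/
def multiD (β : Fin n → ℕ) (f : Euc n → 𝕜) : Euc n → 𝕜 :=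
  (multiList β).foldr partialD f

/-- `u ∈ C^∞(cl U)`, for an open set `U`: `u` is of class `C^∞` in `U`, it is continuous on `cl U`,
and each derivative `D^β u` extends from `U` to a continuous function on `cl U`.
Only the values of `u` on `cl U` matter. -/
structure SmoothUpTo (U : Set (Euc n)) (u : Euc n → 𝕜) : Prop where
  contDiffAt : ∀ x ∈ U, ContDiffAt ℝ ∞ u x
  continuousOn : ContinuousOn u (closure U)
  extends_closure : ∀ β : Fin n → ℕ, ∃ g : Euc n → 𝕜,
    ContinuousOn g (closure U) ∧ EqOn g (multiD β u) U

/-- `sup_β ρ^|β| / |β|! · sup_{x ∈ A} |D^β u(x)|`, in `[0, ∞]`. -/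
def roumieuENorm (ρ : ℝ) (A : Set (Euc n)) (u : Euc n → 𝕜) : ℝ≥0∞ :=
  ⨆ β : Fin n → ℕ, ENNReal.ofReal (ρ ^ (∑ j, β j) / ((∑ j, β j).factorial : ℝ)) *
    ⨆ x ∈ A, ‖multiD β u x‖ₑ

/-- `q`-periodicity of a function on a set that is invariant under the translations by `q ℤⁿ`. -/
def PeriodicOn (q : Fin n → ℝ) (S : Set (Euc n)) (u : Euc n → 𝕜) : Prop :=
  ∀ x ∈ S, ∀ z : Fin n → ℤ, u (x + latPt q z) = u x

/-- `sup_{x ∈ Q̃ \ {0}} |h(x)| |x|^lam`, in `[0, ∞]`. -/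
def weightENorm (q : Fin n → ℝ) (lam : ℝ) (h : Euc n → 𝕜) : ℝ≥0∞ :=
  ⨆ x ∈ centeredCell q \ {0}, ‖h x‖ₑ * ENNReal.ofReal (‖x‖ ^ lam)

/-- The norm of `A¹_{q,lam}`:
`‖h‖_{A⁰_{q,lam}} + ∑_j ‖∂h/∂x_j‖_{A⁰_{q,lam+1}}`, in `[0, ∞]`. -/
def kernelENorm (q : Fin n → ℝ) (lam : ℝ) (h : Euc n → 𝕜) : ℝ≥0∞ :=
  weightENorm q lam h + ∑ j, weightENorm q (lam + 1) (partialD j h)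

/-! Elementary facts on the derivatives and the extended norms. -/

lemma contDiffAt_partialD {x : Euc n} (j : Fin n) {f : Euc n → 𝕜} (hf : ContDiffAt ℝ ∞ f x) :
    ContDiffAt ℝ ∞ (partialD j f) x :=
  (hf.fderiv_right (m := ∞) (by simp)).clm_apply contDiffAt_const

lemma contDiffAt_foldr {x : Euc n} (L : List (Fin n)) {f : Euc n → 𝕜}
    (hf : ContDiffAt ℝ ∞ f x) : ContDiffAt ℝ ∞ (L.foldr partialD f) x := by
  induction L with
  | nil => exact hf
  | cons j L ih => exact contDiffAt_partialD j ih

lemma partialD_congr {x : Euc n} (j : Fin n) {f g : Euc n → 𝕜} (h : f =ᶠ[𝓝 x] g) :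
    partialD j f =ᶠ[𝓝 x] partialD j g := by
  filter_upwards [h.fderiv (𝕜 := ℝ)] with y hy
  simp [partialD, hy]

lemma partialD_add {x : Euc n} (j : Fin n) {f g : Euc n → 𝕜} (hf : DifferentiableAt ℝ f x)
    (hg : DifferentiableAt ℝ g x) : partialD j (f + g) x = partialD j f x + partialD j g x := by
  simp [partialD, fderiv_add hf hg]

lemma partialD_smul {x : Euc n} (j : Fin n) (c : 𝕜) {f : Euc n → 𝕜}
    (hf : DifferentiableAt ℝ f x) : partialD j (c • f) x = c * partialD j f x := by
  simp [partialD, fderiv_const_smul hf c]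

lemma eventually_differentiableAt {x : Euc n} {f : Euc n → 𝕜} (hf : ContDiffAt ℝ ∞ f x) :
    ∀ᶠ y in 𝓝 x, DifferentiableAt ℝ f y :=
  ((hf.of_le (m := 1) (by simp)).eventually (by simp)).mono
    fun _ h => h.differentiableAt one_ne_zero

lemma foldr_add {x : Euc n} (L : List (Fin n)) {f g : Euc n → 𝕜} (hf : ContDiffAt ℝ ∞ f x)
    (hg : ContDiffAt ℝ ∞ g x) :
    L.foldr partialD (f + g) =ᶠ[𝓝 x] L.foldr partialD f + L.foldr partialD g := by
  induction L with
  | nil => exact .rfl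
  | cons j L ih =>
    refine (partialD_congr j ih).trans ?_
    filter_upwards [eventually_differentiableAt (contDiffAt_foldr L hf),
      eventually_differentiableAt (contDiffAt_foldr L hg)] with y h1 h2
    exact partialD_add j h1 h2

lemma foldr_smul {x : Euc n} (L : List (Fin n)) (c : 𝕜) {f : Euc n → 𝕜}
    (hf : ContDiffAt ℝ ∞ f x) :
    L.foldr partialD (c • f) =ᶠ[𝓝 x] c • L.foldr partialD f := by
  induction L with
  | nil => exact .rfl
  | cons j L ih =>
    refine (partialD_congr j ih).trans ?_
    filter_upwards [eventually_differentiableAt (contDiffAt_foldr L hf)] with y h1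
    exact partialD_smul j c h1

lemma multiD_add {x : Euc n} (β : Fin n → ℕ) {f g : Euc n → 𝕜} (hf : ContDiffAt ℝ ∞ f x)
    (hg : ContDiffAt ℝ ∞ g x) : multiD β (f + g) x = multiD β f x + multiD β g x :=
  (foldr_add (multiList β) hf hg).self_of_nhds

lemma multiD_smul {x : Euc n} (β : Fin n → ℕ) (c : 𝕜) {f : Euc n → 𝕜}
    (hf : ContDiffAt ℝ ∞ f x) : multiD β (c • f) x = c * multiD β f x :=
  (foldr_smul (multiList β) c hf).self_of_nhds

lemma multiD_zero (f : Euc n → 𝕜) : multiD (fun _ => 0) f = f := by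
  have h : multiList (fun _ : Fin n => 0) = [] :=
    List.flatMap_eq_nil_iff.2 fun _ _ => rfl
  rw [multiD, h, List.foldr_nil]

lemma foldr_zero_fun (L : List (Fin n)) : L.foldr partialD (0 : Euc n → 𝕜) = 0 := by
  induction L with
  | nil => rfl
  | cons j L ih => rw [List.foldr_cons, ih]; ext x; simp [partialD]

lemma multiD_zero_fun (β : Fin n → ℕ) : multiD β (0 : Euc n → 𝕜) = 0 := foldr_zero_fun _

lemma SmoothUpTo.zero (U : Set (Euc n)) : SmoothUpTo U (0 : Euc n → 𝕜) where
  contDiffAt _ _ := contDiffAt_const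
  continuousOn := continuousOn_const
  extends_closure β := ⟨0, continuousOn_const, by rw [multiD_zero_fun]; exact fun _ _ => rfl⟩

lemma SmoothUpTo.add {U : Set (Euc n)} {u v : Euc n → 𝕜} (hu : SmoothUpTo U u)
    (hv : SmoothUpTo U v) : SmoothUpTo U (u + v) where
  contDiffAt x hx := (hu.contDiffAt x hx).add (hv.contDiffAt x hx)
  continuousOn := hu.continuousOn.add hv.continuousOn
  extends_closure β := by
    obtain ⟨f, hf, hf'⟩ := hu.extends_closure β
    obtain ⟨g, hg, hg'⟩ := hv.extends_closure β
    refine ⟨f + g, hf.add hg, fun x hx => ?_⟩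
    rw [multiD_add β (hu.contDiffAt x hx) (hv.contDiffAt x hx), Pi.add_apply, hf' hx, hg' hx]

lemma SmoothUpTo.smul {U : Set (Euc n)} (c : 𝕜) {u : Euc n → 𝕜} (hu : SmoothUpTo U u) :
    SmoothUpTo U (c • u) where
  contDiffAt x hx := (hu.contDiffAt x hx).const_smul c
  continuousOn := hu.continuousOn.const_smul c
  extends_closure β := by
    obtain ⟨f, hf, hf'⟩ := hu.extends_closure β
    refine ⟨c • f, hf.const_smul c, fun x hx => ?_⟩
    rw [multiD_smul β c (hu.contDiffAt x hx), Pi.smul_apply, hf' hx, smul_eq_mul]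

lemma roumieuENorm_zero (ρ : ℝ) (A : Set (Euc n)) :
    roumieuENorm ρ A (0 : Euc n → 𝕜) = 0 := by
  simp [roumieuENorm, multiD_zero_fun]

lemma roumieuENorm_add (ρ : ℝ) {A : Set (Euc n)} {u v : Euc n → 𝕜}
    (hu : ∀ x ∈ A, ContDiffAt ℝ ∞ u x) (hv : ∀ x ∈ A, ContDiffAt ℝ ∞ v x) :
    roumieuENorm ρ A (u + v) ≤ roumieuENorm ρ A u + roumieuENorm ρ A v := by
  refine iSup_le fun β => ?_
  refine le_trans ?_ (add_le_add (le_iSup _ β) (le_iSup _ β))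
  rw [← mul_add]
  gcongr
  refine iSup₂_le fun x hx => ?_
  rw [multiD_add β (hu x hx) (hv x hx)]
  exact (enorm_add_le _ _).trans (add_le_add (le_iSup₂_of_le x hx le_rfl)
    (le_iSup₂_of_le x hx le_rfl))

lemma roumieuENorm_smul (ρ : ℝ) {A : Set (Euc n)} (c : 𝕜) {u : Euc n → 𝕜}
    (hu : ∀ x ∈ A, ContDiffAt ℝ ∞ u x) :
    roumieuENorm ρ A (c • u) = ‖c‖ₑ * roumieuENorm ρ A u := by
  simp only [roumieuENorm, ENNReal.mul_iSup]
  refine iSup_congr fun β => iSup_congr fun x => iSup_congr fun hx => ?_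
  rw [multiD_smul β c (hu x hx), enorm_mul, mul_left_comm]

lemma eq_zero_of_roumieuENorm {ρ : ℝ} {A : Set (Euc n)} {u : Euc n → 𝕜}
    (h : roumieuENorm ρ A u = 0) : ∀ x ∈ A, u x = 0 := by
  intro x hx
  have h0 := (ENNReal.iSup_eq_zero.1 h) (fun _ => 0)
  simpa [multiD_zero] using (by simpa [multiD_zero] using h0 : ∀ x ∈ A, u x = 0) x hx

lemma weightENorm_zero (q : Fin n → ℝ) (lam : ℝ) :
    weightENorm q lam (0 : Euc n → 𝕜) = 0 := by
  simp [weightENorm]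

lemma weightENorm_add_le (q : Fin n → ℝ) (lam : ℝ) {f g h : Euc n → 𝕜}
    (H : ∀ x ∈ centeredCell q \ {0}, h x = f x + g x) :
    weightENorm q lam h ≤ weightENorm q lam f + weightENorm q lam g := by
  refine iSup₂_le fun x hx => ?_
  rw [H x hx]
  refine (mul_le_mul_left (enorm_add_le (f x) (g x)) _).trans ?_
  rw [add_mul]
  exact add_le_add (le_iSup₂_of_le x hx le_rfl) (le_iSup₂_of_le x hx le_rfl)

lemma weightENorm_smul (q : Fin n → ℝ) (lam : ℝ) (c : 𝕜) {f h : Euc n → 𝕜}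
    (H : ∀ x ∈ centeredCell q \ {0}, h x = c * f x) :
    weightENorm q lam h = ‖c‖ₑ * weightENorm q lam f := by
  simp only [weightENorm, ENNReal.mul_iSup]
  refine iSup_congr fun x => iSup_congr fun hx => ?_
  rw [H x hx, enorm_mul, mul_assoc]

lemma latPt_add (q : Fin n → ℝ) (z w : Fin n → ℤ) :
    latPt q (z + w) = latPt q z + latPt q w := by
  ext j; simp [latPt, mul_add]

lemma latPt_neg (q : Fin n → ℝ) (z : Fin n → ℤ) : latPt q (-z) = -latPt q z := by
  ext j; simp [latPt]

lemma add_latPt_mem_perSet {q : Fin n → ℝ} {Ω : Set (Euc n)} {x : Euc n}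
    (hx : x ∈ perSet q Ω) (z : Fin n → ℤ) : x + latPt q z ∈ perSet q Ω := by
  obtain ⟨w, y, hy, rfl⟩ := mem_iUnion.1 hx
  exact mem_iUnion.2 ⟨w + z, y, hy, by simp only [latPt_add]; abel⟩

lemma add_latPt_mem_closure_perSet {q : Fin n → ℝ} {Ω : Set (Euc n)} {x : Euc n}
    (hx : x ∈ closure (perSet q Ω)) (z : Fin n → ℤ) :
    x + latPt q z ∈ closure (perSet q Ω) :=
  map_mem_closure (f := fun y => y + latPt q z) (by fun_prop) hx
    fun _ hy => add_latPt_mem_perSet hy z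

lemma add_latPt_mem_perSetExt {q : Fin n → ℝ} {Ω : Set (Euc n)} {x : Euc n}
    (hx : x ∈ perSetExt q Ω) (z : Fin n → ℤ) : x + latPt q z ∈ perSetExt q Ω := by
  intro h
  refine hx ?_
  have := add_latPt_mem_closure_perSet h (-z)
  rwa [latPt_neg, add_neg_cancel_right] at this

lemma add_latPt_mem_compl_lattice {q : Fin n → ℝ} {x : Euc n}
    (hx : x ∈ (lattice q)ᶜ) (z : Fin n → ℤ) : x + latPt q z ∈ (lattice q)ᶜ := by
  rintro ⟨w, hw⟩
  exact hx ⟨w - z, by rw [sub_eq_add_neg, latPt_add, latPt_neg, hw]; abel⟩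

lemma mem_closure_cell {q : Fin n → ℝ} (hq : ∀ j, 0 < q j) {x : Euc n}
    (hx : ∀ j, 0 ≤ x j ∧ x j ≤ q j) : x ∈ closure (cell q) := by
  let c : Euc n := WithLp.toLp 2 (fun j => q j / 2)
  have hlim : Tendsto (fun t : ℝ => x + t • (c - x)) (𝓝[>] 0) (𝓝 x) := by
    have : Continuous (fun t : ℝ => x + t • (c - x)) := by fun_prop
    simpa using (this.tendsto 0).mono_left nhdsWithin_le_nhds
  refine mem_closure_of_tendsto hlim ?_
  filter_upwards [Ioo_mem_nhdsGT (zero_lt_one' ℝ)] with t ht j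
  have := hx j
  have h2 := hq j
  simp only [PiLp.add_apply, PiLp.smul_apply, PiLp.sub_apply, smul_eq_mul, c]
  obtain ⟨h0, h1⟩ := ht
  constructor <;> nlinarith [mul_pos h0 h2, mul_nonneg (sub_nonneg.2 h1.le) this.1,
    mul_nonneg (sub_nonneg.2 h1.le) (sub_nonneg.2 this.2)]

lemma exists_sub_mem_closure_cell {q : Fin n → ℝ} (hq : ∀ j, 0 < q j) (x : Euc n) :
    ∃ z : Fin n → ℤ, x + latPt q z ∈ closure (cell q) := by
  refine ⟨fun j => -⌊x j / q j⌋, mem_closure_cell hq fun j => ?_⟩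
  have h := hq j
  have h1 := Int.floor_le (x j / q j)
  have h2 := (Int.lt_floor_add_one (x j / q j)).le
  rw [le_div_iff₀ h] at h1
  rw [div_le_iff₀ h] at h2
  simp only [latPt, PiLp.add_apply, Int.cast_neg]
  constructor <;> linarith

lemma exists_sub_half {q : Fin n → ℝ} (hq : ∀ j, 0 < q j) (x : Euc n) :
    ∃ z : Fin n → ℤ, ∀ j, |(x + latPt q z) j| ≤ q j / 2 := by
  refine ⟨fun j => -round (x j / q j), fun j => ?_⟩
  have h := hq j
  have h1 := abs_sub_round (x j / q j)
  have h2 : (x + latPt q fun j => -round (x j / q j)) j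
      = q j * (x j / q j - round (x j / q j)) := by
    simp only [latPt, PiLp.add_apply, Int.cast_neg]
    field_simp
    ring
  rw [h2, abs_mul, abs_of_pos h]
  nlinarith

lemma notMem_lattice_of_mem_centeredCell {q : Fin n → ℝ} {x : Euc n}
    (hx : x ∈ centeredCell q \ {0}) : x ∉ lattice q := by
  rintro ⟨z, rfl⟩
  refine hx.2 ?_
  have hz : z = 0 := by
    funext j
    have h := hx.1 j
    simp only [latPt] at h
    have hq : 0 < q j := by linarith [h.1, h.2]
    have h1 : (z j : ℝ) < 1 := by nlinarith [h.2]
    have h2 : (-1 : ℝ) < z j := by nlinarith [h.1]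
    have h1' : z j < 1 := by exact_mod_cast h1
    have h2' : -1 < z j := by exact_mod_cast h2
    simp only [Pi.zero_apply]
    omega
  subst hz
  ext j
  simp [latPt]

lemma kernelENorm_add {q : Fin n → ℝ} {lam : ℝ} {f g : Euc n → 𝕜}
    (hf : ∀ x ∉ lattice q, ContDiffAt ℝ 1 f x) (hg : ∀ x ∉ lattice q, ContDiffAt ℝ 1 g x) :
    kernelENorm q lam (f + g) ≤ kernelENorm q lam f + kernelENorm q lam g := by
  unfold kernelENorm
  rw [add_add_add_comm, ← Finset.sum_add_distrib]
  refine add_le_add (weightENorm_add_le q lam fun x _ => rfl)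
    (Finset.sum_le_sum fun j _ => weightENorm_add_le q (lam + 1) fun x hx => ?_)
  have hx' := notMem_lattice_of_mem_centeredCell hx
  exact partialD_add j ((hf x hx').differentiableAt one_ne_zero)
    ((hg x hx').differentiableAt one_ne_zero)

lemma kernelENorm_smul {q : Fin n → ℝ} {lam : ℝ} (c : 𝕜) {f : Euc n → 𝕜}
    (hf : ∀ x ∉ lattice q, ContDiffAt ℝ 1 f x) :
    kernelENorm q lam (c • f) = ‖c‖ₑ * kernelENorm q lam f := by
  unfold kernelENorm
  rw [mul_add, Finset.mul_sum, weightENorm_smul q lam c (f := f) (h := c • f) fun x _ => rfl]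
  congr 1
  refine Finset.sum_congr rfl fun j _ => weightENorm_smul q (lam + 1) c fun x hx => ?_
  exact partialD_smul j c
    ((hf x (notMem_lattice_of_mem_centeredCell hx)).differentiableAt one_ne_zero)

lemma eq_zero_of_kernelENorm {q : Fin n → ℝ} (hq : ∀ j, 0 < q j) {lam : ℝ} {h : Euc n → 𝕜}
    (hc : ∀ x ∉ lattice q, ContDiffAt ℝ 1 h x) (hp : PeriodicOn q (lattice q)ᶜ h)
    (h0 : kernelENorm q lam h = 0) : ∀ x ∉ lattice q, h x = 0 := by
  have key : ∀ x ∈ centeredCell q \ {0}, h x = 0 := by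
    intro x hx
    have h1 : weightENorm q lam h = 0 := (add_eq_zero.1 h0).1
    have h2 : ‖h x‖ₑ * ENNReal.ofReal (‖x‖ ^ lam) = 0 :=
      le_antisymm (h1 ▸ le_iSup₂_of_le (f := fun x (_ : x ∈ centeredCell q \ {0}) =>
        ‖h x‖ₑ * ENNReal.ofReal (‖x‖ ^ lam)) x hx le_rfl) zero_le
    rcases mul_eq_zero.1 h2 with h3 | h3
    · simpa using h3
    · exact absurd (ENNReal.ofReal_eq_zero.1 h3)
        (not_le.2 (Real.rpow_pos_of_pos (norm_pos_iff.2 hx.2) _))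
  intro x hx
  obtain ⟨z, hz⟩ := exists_sub_half hq x
  rw [← hp x hx z]
  set y := x + latPt q z with hy
  have hyl : y ∉ lattice q := add_latPt_mem_compl_lattice hx z
  have hy0 : y ≠ 0 := fun h => hyl ⟨0, by rw [h]; ext j; simp [latPt]⟩
  have hlim : Tendsto (fun t : ℝ => t • y) (𝓝[<] 1) (𝓝 y) := by
    have : Continuous (fun t : ℝ => t • y) := by fun_prop
    simpa using (this.tendsto 1).mono_left nhdsWithin_le_nhds
  have hlim2 := (hc y hyl).continuousAt.tendsto.comp hlim
  refine tendsto_nhds_unique hlim2 (tendsto_const_nhds.congr' ?_)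
  filter_upwards [Ioo_mem_nhdsLT (zero_lt_one' ℝ)] with t ht
  refine (key _ ⟨fun j => ?_, by simp [ht.1.ne', hy0]⟩).symm
  have h1 := abs_le.1 (hz j)
  have h2 := hq j
  simp only [PiLp.smul_apply, smul_eq_mul]
  obtain ⟨ht0, ht1⟩ := ht
  constructor <;> nlinarith [mul_le_mul_of_nonneg_left h1.1 ht0.le,
    mul_le_mul_of_nonneg_left h1.2 ht0.le, mul_pos (sub_pos.2 ht1) h2]

lemma eq_zero_on_closure {U : Set (Euc n)} {u : Euc n → 𝕜} (hu : ContinuousOn u (closure U))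
    (h : ∀ x ∈ U, u x = 0) : ∀ x ∈ closure U, u x = 0 := by
  intro x hx
  have hcl : IsClosed (closure U ∩ u ⁻¹' {0}) :=
    hu.preimage_isClosed_of_isClosed isClosed_closure isClosed_singleton
  have hsub : U ⊆ closure U ∩ u ⁻¹' {0} := fun z hz => ⟨subset_closure hz, h z hz⟩
  exact (closure_minimal hsub hcl hx).2

end Derivatives

section Spaces

variable (𝕜 : Type*) [RCLike 𝕜] {n : ℕ}

/-! Throughout, a function on a set `S ⊆ ℝⁿ` is represented by its extension by zero to `ℝⁿ`. -/

/-- The smooth functions on `cl U` for which the extended Roumieu norm with suprema over `A ⊆ U`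
is finite. -/
def roumieuSubmodule (ρ : ℝ) (U A : Set (Euc n)) (hA : A ⊆ U) : Submodule 𝕜 (Euc n → 𝕜) where
  carrier := {u | (∀ x ∉ closure U, u x = 0) ∧ SmoothUpTo U u ∧ roumieuENorm ρ A u < ⊤}
  zero_mem' := ⟨fun _ _ => rfl, SmoothUpTo.zero U, by simp [roumieuENorm_zero]⟩
  add_mem' := by
    rintro u v ⟨hu, hu', hu''⟩ ⟨hv, hv', hv''⟩
    exact ⟨fun x hx => by simp [hu x hx, hv x hx], hu'.add hv',
      (roumieuENorm_add ρ (fun x hx => hu'.contDiffAt x (hA hx))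
        (fun x hx => hv'.contDiffAt x (hA hx))).trans_lt (ENNReal.add_lt_top.2 ⟨hu'', hv''⟩)⟩
  smul_mem' := by
    rintro c u ⟨hu, hu', hu''⟩
    refine ⟨fun x hx => by simp [hu x hx], hu'.smul c, ?_⟩
    rw [roumieuENorm_smul ρ c (fun x hx => hu'.contDiffAt x (hA hx))]
    exact ENNReal.mul_lt_top enorm_lt_top hu''

/-- The `q`-periodic functions on `S`. -/
def periodicSubmodule (q : Fin n → ℝ) (S : Set (Euc n)) : Submodule 𝕜 (Euc n → 𝕜) where
  carrier := {u | PeriodicOn q S u}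
  zero_mem' := fun _ _ _ => rfl
  add_mem' := fun hu hv x hx z => by simp [hu x hx z, hv x hx z]
  smul_mem' := fun c u hu x hx z => by simp [hu x hx z]

lemma subset_perSet (q : Fin n → ℝ) (Ω : Set (Euc n)) : Ω ⊆ perSet q Ω := fun x hx =>
  mem_iUnion.2 ⟨0, x, hx, by ext j; simp [latPt]⟩

/-- The Roumieu class `C⁰_{ω,ρ}(cl Ω)`, with values in `𝕜`. The supremum of `|D^β u|` over `Ω` in
the norm is the one over `cl Ω` of its continuous extension. -/
def Roumieu (ρ : ℝ) (Ω : Set (Euc n)) : Type _ :=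
  ↥(roumieuSubmodule 𝕜 ρ Ω Ω subset_rfl)

/-- The periodic Roumieu class `C⁰_{q,ω,ρ}(cl 𝕊[Ω])`; its norm takes the suprema of `|D^β u|` over
`Ω` (equivalently, of the continuous extensions over `cl Ω`). The boundedness of the derivatives
on all of `𝕊[Ω]` follows by periodicity. -/
def PerRoumieu (q : Fin n → ℝ) (ρ : ℝ) (Ω : Set (Euc n)) : Type _ :=
  ↥(roumieuSubmodule 𝕜 ρ (perSet q Ω) Ω (subset_perSet q Ω) ⊓
    periodicSubmodule 𝕜 q (closure (perSet q Ω)))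

/-- The periodic Roumieu class `C⁰_{q,ω,ρ}(cl 𝕊[Ω]⁻)`. Its norm takes the suprema of `|D^β u|` over
`𝕊[Ω]⁻ ∩ cl Q`, which is `cl Q \ cl Ω` if `cl Ω ⊆ Q`. If moreover `Ω` is Lipschitz, then this set is
dense in `cl Q \ Ω`, so that these are the suprema of the continuous extensions over `cl Q \ Ω`. -/
def PerRoumieuExt (q : Fin n → ℝ) (ρ : ℝ) (Ω : Set (Euc n)) : Type _ :=
  ↥(roumieuSubmodule 𝕜 ρ (perSetExt q Ω) (perSetExt q Ω ∩ closure (cell q)) inter_subset_left ⊓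
    periodicSubmodule 𝕜 q (closure (perSetExt q Ω)))

/-- The kernels `h ∈ A¹_{q,lam}` (functions on `ℝⁿ \ q ℤⁿ`) with `h|cl G ∈ C⁰_{ω,ρ}(cl G)`. -/
def kernelSubmodule (q : Fin n → ℝ) (lam ρ : ℝ) (G : Set (Euc n)) :
    Submodule 𝕜 (Euc n → 𝕜) where
  carrier := {h | (∀ x ∈ lattice q, h x = 0) ∧ (∀ x ∉ lattice q, ContDiffAt ℝ 1 h x) ∧
    PeriodicOn q (lattice q)ᶜ h ∧ kernelENorm q lam h < ⊤ ∧
    SmoothUpTo G h ∧ roumieuENorm ρ G h < ⊤}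
  zero_mem' := by
    refine ⟨fun _ _ => rfl, fun _ _ => contDiffAt_const, fun _ _ _ => rfl, ?_,
      SmoothUpTo.zero G, by simp [roumieuENorm_zero]⟩
    have (j : Fin n) : partialD j (0 : Euc n → 𝕜) = 0 := foldr_zero_fun [j]
    simp [kernelENorm, weightENorm_zero, this]
  add_mem' := by
    rintro f g ⟨f1, f2, f3, f4, f5, f6⟩ ⟨g1, g2, g3, g4, g5, g6⟩
    exact ⟨fun x hx => by simp [f1 x hx, g1 x hx], fun x hx => (f2 x hx).add (g2 x hx),
      fun x hx z => by simp [f3 x hx z, g3 x hx z],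
      (kernelENorm_add f2 g2).trans_lt (ENNReal.add_lt_top.2 ⟨f4, g4⟩), f5.add g5,
      (roumieuENorm_add ρ f5.contDiffAt g5.contDiffAt).trans_lt (ENNReal.add_lt_top.2 ⟨f6, g6⟩)⟩
  smul_mem' := by
    rintro c f ⟨f1, f2, f3, f4, f5, f6⟩
    refine ⟨fun x hx => by simp [f1 x hx], fun x hx => (f2 x hx).const_smul c,
      fun x hx z => by simp [f3 x hx z], ?_, f5.smul c, ?_⟩
    · rw [kernelENorm_smul c f2]
      exact ENNReal.mul_lt_top enorm_lt_top f4
    · rw [roumieuENorm_smul ρ c f5.contDiffAt]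
      exact ENNReal.mul_lt_top enorm_lt_top f6

/-- The space `H_q^{lam,ρ}(G)`. -/
def HKernel (q : Fin n → ℝ) (lam ρ : ℝ) (G : Set (Euc n)) : Type _ :=
  ↥(kernelSubmodule 𝕜 q lam ρ G)

section Instances

variable {𝕜}
variable {q : Fin n → ℝ} {lam ρ : ℝ} {Ω G : Set (Euc n)}

instance : AddCommGroup (Roumieu 𝕜 ρ Ω) :=
  inferInstanceAs (AddCommGroup ↥(roumieuSubmodule 𝕜 ρ Ω Ω subset_rfl))

instance : Module 𝕜 (Roumieu 𝕜 ρ Ω) :=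
  inferInstanceAs (Module 𝕜 ↥(roumieuSubmodule 𝕜 ρ Ω Ω subset_rfl))

instance : CoeFun (Roumieu 𝕜 ρ Ω) (fun _ => Euc n → 𝕜) := ⟨fun u => u.1⟩

instance : AddCommGroup (PerRoumieu 𝕜 q ρ Ω) :=
  inferInstanceAs (AddCommGroup ↥(roumieuSubmodule 𝕜 ρ (perSet q Ω) Ω (subset_perSet q Ω) ⊓
    periodicSubmodule 𝕜 q (closure (perSet q Ω))))

instance : Module 𝕜 (PerRoumieu 𝕜 q ρ Ω) :=
  inferInstanceAs (Module 𝕜 ↥(roumieuSubmodule 𝕜 ρ (perSet q Ω) Ω (subset_perSet q Ω) ⊓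
    periodicSubmodule 𝕜 q (closure (perSet q Ω))))

instance : CoeFun (PerRoumieu 𝕜 q ρ Ω) (fun _ => Euc n → 𝕜) := ⟨fun u => u.1⟩

instance : AddCommGroup (PerRoumieuExt 𝕜 q ρ Ω) :=
  inferInstanceAs (AddCommGroup ↥(roumieuSubmodule 𝕜 ρ (perSetExt q Ω)
    (perSetExt q Ω ∩ closure (cell q)) inter_subset_left ⊓
    periodicSubmodule 𝕜 q (closure (perSetExt q Ω))))

instance : Module 𝕜 (PerRoumieuExt 𝕜 q ρ Ω) :=
  inferInstanceAs (Module 𝕜 ↥(roumieuSubmodule 𝕜 ρ (perSetExt q Ω)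
    (perSetExt q Ω ∩ closure (cell q)) inter_subset_left ⊓
    periodicSubmodule 𝕜 q (closure (perSetExt q Ω))))

instance : CoeFun (PerRoumieuExt 𝕜 q ρ Ω) (fun _ => Euc n → 𝕜) := ⟨fun u => u.1⟩

instance : AddCommGroup (HKernel 𝕜 q lam ρ G) :=
  inferInstanceAs (AddCommGroup ↥(kernelSubmodule 𝕜 q lam ρ G))

instance : Module 𝕜 (HKernel 𝕜 q lam ρ G) :=
  inferInstanceAs (Module 𝕜 ↥(kernelSubmodule 𝕜 q lam ρ G))

instance : CoeFun (HKernel 𝕜 q lam ρ G) (fun _ => Euc n → 𝕜) := ⟨fun h => h.1⟩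

/-- `‖u‖ = sup_β ρ^|β| / |β|! · sup_{cl Ω} |D^β u|`. -/
instance : Norm (Roumieu 𝕜 ρ Ω) := ⟨fun u => (roumieuENorm ρ Ω u).toReal⟩

/-- `‖u‖ = sup_β ρ^|β| / |β|! · sup_{cl Ω} |D^β u|`. -/
instance : Norm (PerRoumieu 𝕜 q ρ Ω) := ⟨fun u => (roumieuENorm ρ Ω u).toReal⟩

/-- `‖u‖ = sup_β ρ^|β| / |β|! · sup_{cl Q \ Ω} |D^β u|`. -/
instance : Norm (PerRoumieuExt 𝕜 q ρ Ω) :=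
  ⟨fun u => (roumieuENorm ρ (perSetExt q Ω ∩ closure (cell q)) u).toReal⟩

/-- `‖h‖ = ‖h‖_{A¹_{q,lam}} + ‖h‖_{C⁰_{ω,ρ}(cl G)}`. -/
instance : Norm (HKernel 𝕜 q lam ρ G) :=
  ⟨fun h => (kernelENorm q lam h).toReal + (roumieuENorm ρ G h).toReal⟩

lemma toReal_add_le {a b c : ℝ≥0∞} (hb : b < ⊤) (hc : c < ⊤) (h : a ≤ b + c) :
    a.toReal ≤ b.toReal + c.toReal := by
  rw [← ENNReal.toReal_add hb.ne hc.ne]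
  exact ENNReal.toReal_mono (ENNReal.add_lt_top.2 ⟨hb, hc⟩).ne h

lemma toReal_smul_eq {a b : ℝ≥0∞} {c : 𝕜} (h : a = ‖c‖ₑ * b) : a.toReal = ‖c‖ * b.toReal := by
  rw [h, ENNReal.toReal_mul, toReal_enorm]

lemma roumieu_core : NormedSpace.Core 𝕜 (Roumieu 𝕜 ρ Ω) where
  norm_nonneg _ := ENNReal.toReal_nonneg
  norm_smul c u := toReal_smul_eq (roumieuENorm_smul ρ c u.2.2.1.contDiffAt)
  norm_triangle u v := toReal_add_le u.2.2.2 v.2.2.2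
    (roumieuENorm_add ρ u.2.2.1.contDiffAt v.2.2.1.contDiffAt)
  norm_eq_zero_iff u := by
    refine ⟨fun h => ?_, fun h => h ▸ by
      change (roumieuENorm ρ Ω (0 : Euc n → 𝕜)).toReal = 0
      simp [roumieuENorm_zero]⟩
    have h0 := eq_zero_of_roumieuENorm
      (((ENNReal.toReal_eq_zero_iff _).1 h).resolve_right u.2.2.2.ne)
    refine Subtype.ext (funext fun x => ?_)
    by_cases hx : x ∈ closure Ω
    · exact eq_zero_on_closure u.2.2.1.continuousOn h0 x hx
    · exact u.2.1 x hx

lemma perRoumieu_core : NormedSpace.Core 𝕜 (PerRoumieu 𝕜 q ρ Ω) where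
  norm_nonneg _ := ENNReal.toReal_nonneg
  norm_smul c u := toReal_smul_eq (roumieuENorm_smul ρ c
    fun x hx => u.2.1.2.1.contDiffAt x (subset_perSet q Ω hx))
  norm_triangle u v := toReal_add_le u.2.1.2.2 v.2.1.2.2
    (roumieuENorm_add ρ (fun x hx => u.2.1.2.1.contDiffAt x (subset_perSet q Ω hx))
      fun x hx => v.2.1.2.1.contDiffAt x (subset_perSet q Ω hx))
  norm_eq_zero_iff u := by
    refine ⟨fun h => ?_, fun h => h ▸ by
      change (roumieuENorm ρ Ω (0 : Euc n → 𝕜)).toReal = 0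
      simp [roumieuENorm_zero]⟩
    have h0 := eq_zero_of_roumieuENorm
      (((ENNReal.toReal_eq_zero_iff _).1 h).resolve_right u.2.1.2.2.ne)
    have h1 : ∀ x ∈ perSet q Ω, u x = 0 := by
      intro x hx
      obtain ⟨z, y, hy, rfl⟩ := mem_iUnion.1 hx
      have := u.2.2 y (subset_closure (subset_perSet q Ω hy)) z
      simp only [add_comm (latPt q z) y, this, h0 y hy]
    refine Subtype.ext (funext fun x => ?_)
    by_cases hx : x ∈ closure (perSet q Ω)
    · exact eq_zero_on_closure u.2.1.2.1.continuousOn h1 x hx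
    · exact u.2.1.1 x hx

lemma perRoumieuExt_core (hq : ∀ j, 0 < q j) : NormedSpace.Core 𝕜 (PerRoumieuExt 𝕜 q ρ Ω) where
  norm_nonneg _ := ENNReal.toReal_nonneg
  norm_smul c u := toReal_smul_eq (roumieuENorm_smul ρ c
    fun x hx => u.2.1.2.1.contDiffAt x hx.1)
  norm_triangle u v := toReal_add_le u.2.1.2.2 v.2.1.2.2
    (roumieuENorm_add ρ (fun x hx => u.2.1.2.1.contDiffAt x hx.1)
      fun x hx => v.2.1.2.1.contDiffAt x hx.1)
  norm_eq_zero_iff u := by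
    refine ⟨fun h => ?_, fun h => h ▸ by
      change (roumieuENorm ρ _ (0 : Euc n → 𝕜)).toReal = 0
      simp [roumieuENorm_zero]⟩
    have h0 := eq_zero_of_roumieuENorm
      (((ENNReal.toReal_eq_zero_iff _).1 h).resolve_right u.2.1.2.2.ne)
    have h1 : ∀ x ∈ perSetExt q Ω, u x = 0 := by
      intro x hx
      obtain ⟨z, hz⟩ := exists_sub_mem_closure_cell hq x
      rw [← u.2.2 x (subset_closure hx) z]
      exact h0 _ ⟨add_latPt_mem_perSetExt hx z, hz⟩
    refine Subtype.ext (funext fun x => ?_)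
    by_cases hx : x ∈ closure (perSetExt q Ω)
    · exact eq_zero_on_closure u.2.1.2.1.continuousOn h1 x hx
    · exact u.2.1.1 x hx

lemma hKernel_core (hq : ∀ j, 0 < q j) : NormedSpace.Core 𝕜 (HKernel 𝕜 q lam ρ G) where
  norm_nonneg _ := add_nonneg ENNReal.toReal_nonneg ENNReal.toReal_nonneg
  norm_smul c h := by
    have h1 := toReal_smul_eq (kernelENorm_smul (lam := lam) c h.2.2.1)
    have h2 := toReal_smul_eq (roumieuENorm_smul ρ c h.2.2.2.2.2.1.contDiffAt)
    exact (congrArg₂ (· + ·) h1 h2).trans (mul_add _ _ _).symm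
  norm_triangle f g := by
    have h1 := toReal_add_le f.2.2.2.2.1 g.2.2.2.2.1 (kernelENorm_add f.2.2.1 g.2.2.1)
    have h2 := toReal_add_le f.2.2.2.2.2.2 g.2.2.2.2.2.2
      (roumieuENorm_add ρ f.2.2.2.2.2.1.contDiffAt g.2.2.2.2.2.1.contDiffAt)
    exact (add_le_add h1 h2).trans (add_add_add_comm _ _ _ _).le
  norm_eq_zero_iff h := by
    refine ⟨fun h0 => ?_, fun h0 => h0 ▸ by
      change (kernelENorm q lam (0 : Euc n → 𝕜)).toReal +
        (roumieuENorm ρ G (0 : Euc n → 𝕜)).toReal = 0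
      have (j : Fin n) : partialD j (0 : Euc n → 𝕜) = 0 := foldr_zero_fun [j]
      simp [kernelENorm, weightENorm_zero, roumieuENorm_zero, this]⟩
    have h1 := ((add_eq_zero_iff_of_nonneg ENNReal.toReal_nonneg ENNReal.toReal_nonneg).1 h0).1
    have h2 := eq_zero_of_kernelENorm hq h.2.2.1 h.2.2.2.1
      (((ENNReal.toReal_eq_zero_iff _).1 h1).resolve_right h.2.2.2.2.1.ne)
    refine Subtype.ext (funext fun x => ?_)
    by_cases hx : x ∈ lattice q
    · exact h.2.1 x hx
    · exact h2 x hx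

instance : NormedAddCommGroup (Roumieu 𝕜 ρ Ω) := .ofCore (𝕜 := 𝕜) roumieu_core

instance : NormedSpace 𝕜 (Roumieu 𝕜 ρ Ω) := .ofCore roumieu_core

instance : NormedAddCommGroup (PerRoumieu 𝕜 q ρ Ω) := .ofCore (𝕜 := 𝕜) perRoumieu_core

instance : NormedSpace 𝕜 (PerRoumieu 𝕜 q ρ Ω) := .ofCore perRoumieu_core

instance [hq : Fact (∀ j, 0 < q j)] : NormedAddCommGroup (PerRoumieuExt 𝕜 q ρ Ω) :=
  .ofCore (𝕜 := 𝕜) (perRoumieuExt_core hq.out)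

instance [hq : Fact (∀ j, 0 < q j)] : NormedSpace 𝕜 (PerRoumieuExt 𝕜 q ρ Ω) :=
  .ofCore (perRoumieuExt_core hq.out)

instance [hq : Fact (∀ j, 0 < q j)] : NormedAddCommGroup (HKernel 𝕜 q lam ρ G) :=
  .ofCore (𝕜 := 𝕜) (hKernel_core hq.out)

instance [hq : Fact (∀ j, 0 < q j)] : NormedSpace 𝕜 (HKernel 𝕜 q lam ρ G) :=
  .ofCore (hKernel_core hq.out)

end Instances

end Spaces

section Potentials

variable {𝕜 : Type*} [RCLike 𝕜] {n : ℕ}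

/-- `P⁺[h, φ](x) = ∫_Ω h(x - y) φ(y) dy`. -/
def potentialInt (Ω : Set (Euc n)) (h φ : Euc n → 𝕜) (x : Euc n) : 𝕜 :=
  ∫ y in Ω, h (x - y) * φ y

/-- `P⁻[h, φ](x) = ∫_{Q \ cl Ω} h(x - y) φ(y) dy`. -/
def potentialExt (q : Fin n → ℝ) (Ω : Set (Euc n)) (h φ : Euc n → 𝕜) (x : Euc n) : 𝕜 :=
  ∫ y in cell q \ closure Ω, h (x - y) * φ y

end Potentials

end PeriodicPotential

end

open PeriodicPotential

namespace PeriodicPotential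

/-! Two difficulties have to be kept apart: `h` is singular on the lattice and controlled to all
orders only on `G`, so it cannot take arbitrary derivatives; and the density stops at `∂Ω`, so it
cannot take them either without boundary contributions. A cutoff separates the two. Let `S` be
`𝕊[Ω]` or `𝕊[Ω]⁻`, let `f` be the periodic density on `S`, and let `χ` be smooth and periodic,
supported in `S` and equal to 1 on `S ∩ Q` off a thin neighbourhood `N` of `∂Ω`. For `x` near `cl
Ω₁` and `y ∈ N` the difference `x - y` stays in a compact subset of `G`.

The function `χ D^L f` is smooth and periodic on the whole space, so the derivative `∂_j` of its
convolution with `h` over `Q` is the convolution with `χ ∂_j D^L f` plus `∫_N h(x - y) (∂_j χ D^L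
f)(y) dy` (`PotentialData.partialD_mainTerm`). In integrals over `N` all further derivatives can
fall on `h` (`PotentialData.partialD_boundaryTerm`). Starting from `f = χ f + (1 - χ) f` and
iterating along `L = (l₀, …, l_{m-1})`, the derivative `D^L` of the potential is `∫_Q h · χ D^L f +
∫_N D^L h · (1 - χ) f + ∑_{k<m} ∫_N D^{l₀…l_{k-1}} h · ∂_{l_k} χ · D^{l_{k+1}…l_{m-1}} f`
(`PotentialData.foldr_potential`). Only first derivatives of `χ` occur. This is essential, since a
nontrivial cutoff is not analytic and its higher derivatives obey no bound of the form `C m! / ρ^m`.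

The first two terms are of size `m! / ρ^m`, because `h` is integrable on `Q`: it is bounded by a
multiple of `|x|^(-lam)` in the centered cell and `lam < n`. A term of the sum is of size `k!
(m-1-k)! / ρ^(m-1) ≤ ρ (m! / ρ^m) / m`, so the `m` of them together have the same size
(`PotentialData.norm_foldr_potential_le`). The constant does not depend on `L` and is bilinear in
the norms of `h` and of the density, which yields both membership in the Roumieu class and
continuity. Periodicity carries the result from a neighbourhood of `cl Ω₁` to `cl 𝕊[Ω₁]`. -/

/-! ### Integrals of periodic functions -/

/-- The open box with corner `c` and side lengths `q`. -/
def openBox {n : ℕ} (q c : Fin n → ℝ) : Set (Euc n) := {x | ∀ j, c j < x j ∧ x j < c j + q j}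

/-- The half-open box with corner `c` and side lengths `q`. -/
def halfBox {n : ℕ} (q c : Fin n → ℝ) : Set (Euc n) := {x | ∀ j, x j ∈ Ico (c j) (c j + q j)}

/-- The lattice `q ℤⁿ` as a subgroup. -/
def latticeSubgroup {n : ℕ} (q : Fin n → ℝ) : AddSubgroup (Euc n) :=
  (AddMonoidHom.mk' (latPt q) (latPt_add q)).range

section Boxes

variable {n : ℕ} {q : Fin n → ℝ}

instance : Countable (latticeSubgroup q) := by
  have : Countable ((latticeSubgroup q : AddSubgroup (Euc n)) : Set (Euc n)) := by
    simp only [latticeSubgroup, AddMonoidHom.coe_range]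
    exact (countable_range _).to_subtype
  exact this

lemma isOpen_openBox (c : Fin n → ℝ) : IsOpen (openBox q c) := by
  simp only [openBox, ofPred_forall]
  refine isOpen_iInter_of_finite fun j => ?_
  exact isOpen_Ioo.preimage (f := fun x : Euc n => x j) (by fun_prop)

lemma cell_eq_openBox : cell q = openBox q 0 := by
  ext x; simp [cell, openBox]

lemma centeredCell_eq_openBox : centeredCell q = openBox q (fun j => -(q j / 2)) := by
  ext x
  refine forall_congr' fun j => and_congr Iff.rfl ?_
  rw [show -(q j / 2) + q j = q j / 2 by ring]

lemma isOpen_cell : IsOpen (cell q) := cell_eq_openBox (q := q) ▸ isOpen_openBox 0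

lemma measurableSet_halfBox (c : Fin n → ℝ) : MeasurableSet (halfBox q c) := by
  simp only [halfBox, ofPred_forall]
  exact MeasurableSet.iInter fun j => measurableSet_Ico.preimage (by fun_prop)

/-- Half-open boxes are exact fundamental domains of the lattice, while the potentials are integrals
over open cells; the faces are null sets. -/
lemma openBox_ae_eq_halfBox (c : Fin n → ℝ) :
    openBox q c =ᵐ[volume] halfBox q c := by
  have h1 : openBox q c = (WithLp.ofLp : Euc n → Fin n → ℝ) ⁻¹'
      (pi univ fun j => Ioo (c j) (c j + q j)) := by
    ext x; simp [openBox]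
  have h2 : halfBox q c = (WithLp.ofLp : Euc n → Fin n → ℝ) ⁻¹'
      (pi univ fun j => Ico (c j) (c j + q j)) := by
    ext x; simp [halfBox]
  rw [h1, h2]
  refine (PiLp.volume_preserving_ofLp (Fin n)).quasiMeasurePreserving.preimage_ae_eq ?_
  exact Measure.univ_pi_Ioo_ae_eq_Icc.trans Measure.univ_pi_Ico_ae_eq_Icc.symm

lemma bounded_openBox (c : Fin n → ℝ) : Bornology.IsBounded (openBox q c) := by
  have h1 : openBox q c ⊆ (EuclideanSpace.equiv (Fin n) ℝ) ⁻¹'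
      (Icc c (c + q)) := fun x hx => ⟨fun j => (hx j).1.le, fun j => (hx j).2.le⟩
  refine Bornology.IsBounded.subset ?_ h1
  have : IsCompact ((EuclideanSpace.equiv (Fin n) ℝ) ⁻¹' (Icc c (c + q))) :=
    (EuclideanSpace.equiv (Fin n) ℝ).toHomeomorph.isCompact_preimage.2 isCompact_Icc
  exact this.isBounded

lemma isBounded_cell : Bornology.IsBounded (cell q) :=
  cell_eq_openBox (q := q) ▸ bounded_openBox 0

/-- In each coordinate exactly one integer multiple of `q j` brings a given number into the
half-open interval. -/
lemma isAddFundamentalDomain_halfBox (hq : ∀ j, 0 < q j) (c : Fin n → ℝ) :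
    IsAddFundamentalDomain (latticeSubgroup q) (halfBox q c) (volume : Measure (Euc n)) := by
  refine IsAddFundamentalDomain.mk' (measurableSet_halfBox c).nullMeasurableSet fun x => ?_
  choose m hm hm' using fun j => existsUnique_add_zsmul_mem_Ico (hq j) (x j) (c j)
  refine ⟨⟨latPt q m, m, rfl⟩, fun j => ?_, ?_⟩
  · have := hm j
    simp only [zsmul_eq_mul] at this
    simpa [latPt, AddSubgroup.vadd_def, mul_comm, add_comm] using this
  · rintro ⟨_, w, rfl⟩ hw
    have : w = m := by
      funext j
      refine hm' j (w j) ?_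
      have := hw j
      simpa [latPt, AddSubgroup.vadd_def, mul_comm, add_comm] using this
    subst this
    rfl

variable {E : Type*} [NormedAddCommGroup E]

lemma integrableOn_openBox_iff (hq : ∀ j, 0 < q j) (c c' : Fin n → ℝ) {f : Euc n → E}
    (hf : ∀ x z, f (x + latPt q z) = f x) :
    IntegrableOn f (openBox q c) ↔ IntegrableOn f (openBox q c') := by
  rw [integrableOn_congr_set_ae (openBox_ae_eq_halfBox c),
    integrableOn_congr_set_ae (openBox_ae_eq_halfBox c')]
  refine (isAddFundamentalDomain_halfBox hq c).integrableOn_iff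
    (isAddFundamentalDomain_halfBox hq c') ?_
  rintro ⟨_, z, rfl⟩ x
  simpa [AddSubgroup.vadd_def, add_comm] using hf x z

lemma setIntegral_openBox_eq [NormedSpace ℝ E] (hq : ∀ j, 0 < q j) (c c' : Fin n → ℝ)
    {f : Euc n → E} (hf : ∀ x z, f (x + latPt q z) = f x) :
    ∫ x in openBox q c, f x = ∫ x in openBox q c', f x := by
  rw [setIntegral_congr_set (openBox_ae_eq_halfBox c),
    setIntegral_congr_set (openBox_ae_eq_halfBox c')]
  refine (isAddFundamentalDomain_halfBox hq c).setIntegral_eq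
    (isAddFundamentalDomain_halfBox hq c') ?_
  rintro ⟨_, z, rfl⟩ x
  simpa [AddSubgroup.vadd_def, add_comm] using hf x z

lemma preimage_sub_left_cell (x : Euc n) :
    (fun y => x - y) ⁻¹' cell q = openBox q (fun j => x j - q j) := by
  ext y
  simp only [cell, openBox, mem_preimage, mem_ofPred_eq, PiLp.sub_apply]
  refine forall_congr' fun j => ?_
  constructor <;> rintro ⟨h1, h2⟩ <;> constructor <;> linarith

lemma measurableEmbedding_sub_left (x : Euc n) : MeasurableEmbedding (fun y : Euc n => x - y) :=
  (Homeomorph.subLeft x).measurableEmbedding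

/-- Reflection and translation do not change the integral of a periodic function over a cell. -/
lemma setIntegral_cell_sub_left [NormedSpace ℝ E] (hq : ∀ j, 0 < q j) (x : Euc n)
    {f : Euc n → E} (hf : ∀ x z, f (x + latPt q z) = f x) :
    ∫ y in cell q, f (x - y) = ∫ y in cell q, f y := by
  -- The map `y ↦ x - y` sends the cell to the box with corner `x - q`, which by periodicity is as
  -- good as the cell.
  have h := (volume.measurePreserving_sub_left x).setIntegral_preimage_emb
    (measurableEmbedding_sub_left x) f (openBox q (fun j => x j - q j))
  rw [cell_eq_openBox, setIntegral_openBox_eq hq 0 (fun j => x j - q j) hf, ← h]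
  have : (fun y => x - y) ⁻¹' openBox q (fun j => x j - q j) = openBox q 0 := by
    rw [← preimage_sub_left_cell, ← cell_eq_openBox, ← preimage_comp]
    ext y; simp
  rw [this]

lemma integrableOn_cell_sub_left (hq : ∀ j, 0 < q j) (x : Euc n)
    {f : Euc n → E} (hf : ∀ x z, f (x + latPt q z) = f x) (hi : IntegrableOn f (cell q)) :
    IntegrableOn (fun y => f (x - y)) (cell q) := by
  have h := (volume.measurePreserving_sub_left x).integrableOn_comp_preimage
    (measurableEmbedding_sub_left x) (f := f) (s := openBox q (fun j => x j - q j))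
  have h2 : (fun y => x - y) ⁻¹' openBox q (fun j => x j - q j) = cell q := by
    rw [← preimage_sub_left_cell, ← preimage_comp]
    ext y; simp
  rw [h2] at h
  rw [cell_eq_openBox] at hi
  exact h.2 ((integrableOn_openBox_iff hq _ _ hf).1 hi)

end Boxes

/-! ### Integrability of the kernels -/

section Kernels

variable {𝕜 : Type*} [RCLike 𝕜] {n : ℕ} {q : Fin n → ℝ} {lam : ℝ}

/-- In polar coordinates on a ball the integrand becomes `r ^ (n - 1 - lam)`, whose exponent exceeds
`-1`. -/
lemma integrableOn_norm_rpow_neg (hn : 0 < n) (hlam : lam < n) {s : Set (Euc n)}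
    (hs : Bornology.IsBounded s) :
    IntegrableOn (fun x : Euc n => ‖x‖ ^ (-lam)) s := by
  obtain ⟨R, hR, hsR⟩ := hs.subset_ball_lt 0 0
  refine IntegrableOn.mono_set ?_ hsR
  have : Nontrivial (Euc n) := by
    have : Nonempty (Fin n) := ⟨⟨0, hn⟩⟩
    infer_instance
  rw [← integrable_indicator_iff measurableSet_ball]
  have h1 : (Metric.ball (0 : Euc n) R).indicator (fun x : Euc n => ‖x‖ ^ (-lam)) =
      fun x => (Iio R).indicator (fun r : ℝ => r ^ (-lam)) ‖x‖ := by
    ext x; simp [indicator]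
  rw [h1, integrable_fun_norm_addHaar volume (f := (Iio R).indicator (fun r : ℝ => r ^ (-lam)))]
  have h2 : IntegrableOn (fun r : ℝ => r ^ ((n : ℝ) - 1 - lam)) (Ioo 0 R) :=
    (intervalIntegral.integrableOn_Ioo_rpow_iff hR).2 (by linarith)
  rw [← integrable_indicator_iff measurableSet_Ioo] at h2
  rw [← integrable_indicator_iff measurableSet_Ioi]
  refine h2.congr (Eventually.of_forall fun r => ?_)
  simp only [indicator, mem_Ioo, mem_Ioi, mem_Iio, finrank_euclideanSpace, Fintype.card_fin]
  by_cases h0 : 0 < r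
  · by_cases h3 : r < R
    · simp only [h0, h3, and_self, if_true, smul_eq_mul]
      rw [← Real.rpow_natCast, ← Real.rpow_add h0, Nat.cast_sub hn]
      congr 1
      push_cast
      ring
    · simp [h0, h3]
  · simp [h0]

lemma norm_le_of_weightENorm {h : Euc n → 𝕜} (hw : weightENorm q lam h < ⊤) {x : Euc n}
    (hx : x ∈ centeredCell q \ {0}) :
    ‖h x‖ ≤ (weightENorm q lam h).toReal * ‖x‖ ^ (-lam) := by
  have h1 : ‖h x‖ₑ * ENNReal.ofReal (‖x‖ ^ lam) ≤ weightENorm q lam h :=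
    le_iSup₂_of_le (f := fun x (_ : x ∈ centeredCell q \ {0}) =>
        ‖h x‖ₑ * ENNReal.ofReal (‖x‖ ^ lam)) x hx le_rfl
  have h2 := ENNReal.toReal_mono hw.ne h1
  have hx0 : 0 < ‖x‖ := norm_pos_iff.2 hx.2
  rw [ENNReal.toReal_mul, toReal_enorm, ENNReal.toReal_ofReal (by positivity)] at h2
  rw [Real.rpow_neg hx0.le, ← div_eq_mul_inv, le_div_iff₀ (by positivity)]
  exact h2

lemma countable_lattice : (lattice q).Countable := countable_range _

/-- The kernel is continuous off a countable set, which is null because the dimension is positive.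
-/
lemma aestronglyMeasurable_kernel {h : Euc n → 𝕜} (hc : ∀ x ∉ lattice q, ContDiffAt ℝ 1 h x)
    (hn : 0 < n) : AEStronglyMeasurable h (volume : Measure (Euc n)) := by
  have : Nonempty (Fin n) := ⟨⟨0, hn⟩⟩
  have h1 : ContinuousOn h (lattice q)ᶜ := fun x hx => (hc x hx).continuousAt.continuousWithinAt
  have h2 := h1.aestronglyMeasurable (μ := volume) countable_lattice.measurableSet.compl
  have h3 : (volume : Measure (Euc n)).restrict (lattice q)ᶜ = volume := by
    rw [Measure.restrict_eq_self_of_ae_mem]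
    exact compl_mem_ae_iff.2 (countable_lattice.measure_zero _)
  rwa [h3] at h2

/-- The value zero given to `h` on the lattice makes it periodic everywhere, with no exceptional set
to carry along. -/
lemma kernel_periodic {h : Euc n → 𝕜} (h0 : ∀ x ∈ lattice q, h x = 0)
    (hp : PeriodicOn q (lattice q)ᶜ h) (x : Euc n) (z : Fin n → ℤ) :
    h (x + latPt q z) = h x := by
  by_cases hx : x ∈ lattice q
  · obtain ⟨w, rfl⟩ := hx
    rw [← latPt_add, h0 _ ⟨_, rfl⟩, h0 _ ⟨_, rfl⟩]
  · exact hp x hx z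

/-- The weighted bound lives on the centered cell, where the origin is the only singularity. It is
integrated there, and periodicity transfers the result to `Q`, whose vertices are the singular
points. -/
lemma integrableOn_kernel (hq : ∀ j, 0 < q j) (hn : 0 < n) (hlam : lam < n) {h : Euc n → 𝕜}
    (h0 : ∀ x ∈ lattice q, h x = 0) (hc : ∀ x ∉ lattice q, ContDiffAt ℝ 1 h x)
    (hp : PeriodicOn q (lattice q)ᶜ h) (hw : weightENorm q lam h < ⊤) :
    IntegrableOn h (cell q) ∧ ∫ x in cell q, ‖h x‖ ≤ (weightENorm q lam h).toReal *
      ∫ x in centeredCell q, ‖x‖ ^ (-lam) := by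
  have hper := kernel_periodic h0 hp
  have hm := aestronglyMeasurable_kernel hc hn
  have hb : Bornology.IsBounded (centeredCell q) :=
    centeredCell_eq_openBox (q := q) ▸ bounded_openBox _
  have hms : MeasurableSet (centeredCell q) :=
    centeredCell_eq_openBox (q := q) ▸ (isOpen_openBox _).measurableSet
  have hI := (integrableOn_norm_rpow_neg hn hlam hb).const_mul (weightENorm q lam h).toReal
  have hle : ∀ᵐ x ∂(volume.restrict (centeredCell q)),
      ‖h x‖ ≤ (weightENorm q lam h).toReal * ‖x‖ ^ (-lam) := by
    filter_upwards [ae_restrict_mem hms] with x hx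
    by_cases hx0 : x = 0
    · rw [h0 x ⟨0, by rw [hx0]; ext j; simp [latPt]⟩]
      simp only [norm_zero]
      positivity
    · exact norm_le_of_weightENorm hw ⟨hx, hx0⟩
  have hi : IntegrableOn h (centeredCell q) := Integrable.mono' hI hm.restrict hle
  constructor
  · rw [centeredCell_eq_openBox] at hi
    rw [cell_eq_openBox]
    exact (integrableOn_openBox_iff hq _ _ hper).1 hi
  · rw [← integral_const_mul, cell_eq_openBox, setIntegral_openBox_eq hq 0 (fun j => -(q j / 2))
      (f := fun x => ‖h x‖) (fun x z => by rw [hper]), ← centeredCell_eq_openBox]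
    exact integral_mono_ae hi.norm hI hle

end Kernels


/-! ### Partial derivatives -/

section Partials

variable {𝕜 : Type*} [RCLike 𝕜] {n : ℕ}

lemma fderiv_eq_sum_partialD (f : Euc n → 𝕜) (x v : Euc n) :
    fderiv ℝ f x v = ∑ j, v j • partialD j f x := by
  conv_lhs => rw [← (EuclideanSpace.basisFun (Fin n) ℝ).sum_repr v]
  simp [partialD, map_sum]

/-- Induction on the order: the differential in a fixed direction is a linear combination of first
partial derivatives, and `partialD j f` inherits the hypothesis by appending `j` at the inner end of
the list. -/
lemma contDiffOn_of_foldr_partialD {U : Set (Euc n)} (hU : IsOpen U) {f : Euc n → 𝕜}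
    (hf : ∀ L : List (Fin n), DifferentiableOn ℝ (L.foldr partialD f) U) :
    ContDiffOn ℝ ∞ f U := by
  refine contDiffOn_infty.2 fun m => ?_
  induction m generalizing f with
  | zero => exact contDiffOn_zero.2 (hf []).continuousOn
  | succ m ih =>
    rw [Nat.cast_add, Nat.cast_one, contDiffOn_succ_iff_fderiv_of_isOpen hU]
    refine ⟨hf [], by simp, contDiffOn_clm_apply.2 fun v => ?_⟩
    simp only [fderiv_eq_sum_partialD]
    refine ContDiffOn.sum fun j _ => ContDiffOn.const_smul (v j) (ih fun L => ?_)
    simpa using hf (L ++ [j])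

lemma partialD_mul {x : Euc n} (j : Fin n) {f g : Euc n → 𝕜} (hf : DifferentiableAt ℝ f x)
    (hg : DifferentiableAt ℝ g x) :
    partialD j (f * g) x = f x * partialD j g x + partialD j f x * g x := by
  simp [partialD, fderiv_mul hf hg, mul_comm]

lemma partialD_comp_add_right (j : Fin n) (f : Euc n → 𝕜) (a : Euc n) :
    partialD j (fun x => f (x + a)) = fun x => partialD j f (x + a) := by
  ext x
  simp [partialD, fderiv_comp_add_right]

lemma foldr_comp_add_right (L : List (Fin n)) (f : Euc n → 𝕜) (a : Euc n) :
    L.foldr partialD (fun x => f (x + a)) = fun x => L.foldr partialD f (x + a) := by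
  induction L with
  | nil => rfl
  | cons j L ih => rw [List.foldr_cons, ih, partialD_comp_add_right]; rfl

lemma foldr_congr {x : Euc n} (L : List (Fin n)) {f g : Euc n → 𝕜} (h : f =ᶠ[𝓝 x] g) :
    L.foldr partialD f =ᶠ[𝓝 x] L.foldr partialD g := by
  induction L with
  | nil => exact h
  | cons j L ih => exact partialD_congr j ih

lemma PeriodicOn.foldr {q : Fin n → ℝ} {S : Set (Euc n)} (hS : IsOpen S) {f : Euc n → 𝕜}
    (hf : PeriodicOn q S f) (L : List (Fin n)) : PeriodicOn q S (L.foldr partialD f) := by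
  intro x hx z
  have h := (foldr_congr (f := fun y => f (y + latPt q z)) L
    (by filter_upwards [hS.mem_nhds hx] with y hy using hf y hy z)).self_of_nhds
  rwa [foldr_comp_add_right] at h

lemma length_multiList (β : Fin n → ℕ) : (multiList β).length = ∑ j, β j := by
  simp [multiList, List.length_flatMap, ← List.ofFn_eq_map, List.sum_ofFn]

lemma count_multiList (β : Fin n → ℕ) (j : Fin n) : (multiList β).count j = β j := by
  simp only [multiList, List.count_flatMap, Function.comp_def, List.count_replicate]
  simp [← List.ofFn_eq_map, List.sum_ofFn]

lemma partialD_comm {x : Euc n} (i j : Fin n) {f : Euc n → 𝕜} (hf : ContDiffAt ℝ ∞ f x) :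
    partialD i (partialD j f) =ᶠ[𝓝 x] partialD j (partialD i f) := by
  have h2 : ContDiffAt ℝ 2 f x := contDiffAt_infty.1 hf 2
  filter_upwards [h2.eventually (by simp)] with y hy
  have hs := hy.isSymmSndFDerivAt (by simp)
  have hd : DifferentiableAt ℝ (fderiv ℝ f) y :=
    (hy.fderiv_right (m := 1) (by norm_num)).differentiableAt one_ne_zero
  have key : ∀ v w, fderiv ℝ (fun z => fderiv ℝ f z v) y w = fderiv ℝ (fderiv ℝ f) y w v := by
    intro v w
    rw [fderiv_clm_apply hd (differentiableAt_const v)]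
    simp
  change fderiv ℝ (fun z => fderiv ℝ f z _) y _ = fderiv ℝ (fun z => fderiv ℝ f z _) y _
  rw [key, key]
  exact hs _ _

/-- Schwarz's theorem for adjacent swaps. It links the multi-indices of the norms to the lists of
directions, which are the convenient form for inductions. -/
lemma foldr_perm {x : Euc n} {f : Euc n → 𝕜} (hf : ContDiffAt ℝ ∞ f x) {L L' : List (Fin n)}
    (h : L.Perm L') : L.foldr partialD f =ᶠ[𝓝 x] L'.foldr partialD f := by
  induction h with
  | nil => exact .rfl
  | cons j _ ih => exact partialD_congr j ih
  | swap i j L => exact partialD_comm j i (contDiffAt_foldr L hf)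
  | trans _ _ ih1 ih2 => exact ih1.trans ih2

lemma foldr_eq_multiD {x : Euc n} {f : Euc n → 𝕜} (hf : ContDiffAt ℝ ∞ f x) (L : List (Fin n)) :
    L.foldr partialD f x = multiD (fun j => L.count j) f x :=
  (foldr_perm hf (List.perm_iff_count.2 fun j => by rw [count_multiList])).self_of_nhds

lemma sum_count_eq_length (L : List (Fin n)) : ∑ j, L.count j = L.length := by
  rw [← length_multiList]
  exact (List.perm_iff_count.2 fun j => by rw [count_multiList]).length_eq

/-- The bounds given by a Roumieu norm, indexed by lists of directions. -/
lemma norm_foldr_le_of_roumieuENorm {ρ : ℝ} (hρ : 0 < ρ) {A : Set (Euc n)} {u : Euc n → 𝕜}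
    (hu : roumieuENorm ρ A u < ⊤) (L : List (Fin n)) {x : Euc n} (hx : x ∈ A)
    (hux : ContDiffAt ℝ ∞ u x) :
    ‖L.foldr partialD u x‖ ≤ (roumieuENorm ρ A u).toReal * (L.length.factorial / ρ ^ L.length) := by
  have h1 := le_iSup (fun β : Fin n → ℕ =>
    ENNReal.ofReal (ρ ^ (∑ j, β j) / ((∑ j, β j).factorial : ℝ)) *
      ⨆ x ∈ A, ‖multiD β u x‖ₑ) (fun j => L.count j)
  simp only [sum_count_eq_length] at h1
  have h2 : ENNReal.ofReal (ρ ^ L.length / (L.length.factorial : ℝ)) * ‖L.foldr partialD u x‖ₑ ≤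
      roumieuENorm ρ A u := by
    refine le_trans ?_ h1
    gcongr
    rw [foldr_eq_multiD hux]
    exact le_iSup₂_of_le (f := fun x (_ : x ∈ A) => ‖multiD (fun j => L.count j) u x‖ₑ)
      x hx le_rfl
  have h3 := ENNReal.toReal_mono hu.ne h2
  rw [ENNReal.toReal_mul, toReal_enorm, ENNReal.toReal_ofReal (by positivity)] at h3
  have h4 : (0 : ℝ) < L.length.factorial := by exact_mod_cast L.length.factorial_pos
  rw [← mul_div_assoc, le_div_iff₀ (by positivity)]
  rw [div_mul_eq_mul_div, div_le_iff₀ h4] at h3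
  linarith

lemma roumieuENorm_le {ρ : ℝ} (hρ : 0 < ρ) {A : Set (Euc n)} {u : Euc n → 𝕜} {C : ℝ}
    (hu : ∀ β, ∀ x ∈ A, ‖multiD β u x‖ ≤ C * ((∑ j, β j).factorial / ρ ^ (∑ j, β j))) :
    roumieuENorm ρ A u ≤ ENNReal.ofReal C := by
  refine iSup_le fun β => ?_
  rw [ENNReal.mul_iSup]
  refine iSup_le fun x => ?_
  rw [ENNReal.mul_iSup]
  refine iSup_le fun hx => ?_
  rw [← ofReal_norm, ← ENNReal.ofReal_mul (by positivity)]
  refine ENNReal.ofReal_le_ofReal ?_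
  have h := mul_le_mul_of_nonneg_left (hu β x hx)
    (by positivity : 0 ≤ ρ ^ (∑ j, β j) / ((∑ j, β j).factorial : ℝ))
  refine h.trans (le_of_eq ?_)
  have h4 : ((∑ j, β j).factorial : ℝ) ≠ 0 := by exact_mod_cast (Nat.factorial_pos _).ne'
  have h5 : ρ ^ (∑ j, β j) ≠ 0 := by positivity
  field_simp

end Partials

/-! ### Differentiation under the integral sign -/

section Differentiation

variable {𝕜 : Type*} [RCLike 𝕜] {n : ℕ} {q : Fin n → ℝ}

/-- The derivatives of the convolution over a cell of two periodic functions fall on the smooth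
one. -/
lemma partialD_cellConv (hq : ∀ j, 0 < q j) {h ψ : Euc n → 𝕜} (hi : IntegrableOn h (cell q))
    (hh : ∀ x z, h (x + latPt q z) = h x) (hψ : ContDiff ℝ 1 ψ)
    (hψp : ∀ x z, ψ (x + latPt q z) = ψ x) (x : Euc n) :
    DifferentiableAt ℝ (fun x => ∫ y in cell q, h (x - y) * ψ y) x ∧
      ∀ j, partialD j (fun x => ∫ y in cell q, h (x - y) * ψ y) x =
        ∫ y in cell q, h (x - y) * partialD j ψ y := by
  -- The substitution `y ↦ x - y` moves the variable `x` out of the singular kernel and into the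
  -- smooth factor.
  have key : ∀ {g : Euc n → 𝕜}, (∀ x z, g (x + latPt q z) = g x) → ∀ x,
      ∫ y in cell q, h (x - y) * g y = ∫ y in cell q, h y * g (x - y) := by
    intro g hg x
    have := setIntegral_cell_sub_left hq x (f := fun y => h y * g (x - y)) fun y z => by
      rw [hh, sub_add_eq_sub_sub, sub_eq_add_neg, ← latPt_neg, hg]
    simpa using this
  -- For `t` in the unit ball about `x` and `y` in the cell, `t - y` remains in a fixed ball, on
  -- which the differential of `ψ` is bounded; `h` times this bound dominates.
  obtain ⟨R, hR⟩ := (isBounded_cell (q := q)).subset_closedBall 0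
  have hcomp : IsCompact (Metric.closedBall (0 : Euc n) (‖x‖ + 1 + R)) :=
    isCompact_closedBall _ _
  obtain ⟨M, hM⟩ := hcomp.exists_bound_of_continuousOn
    (hψ.continuous_fderiv one_ne_zero).continuousOn
  have hd : HasFDerivAt (fun x => ∫ y in cell q, h y * ψ (x - y))
      (∫ y in cell q, h y • fderiv ℝ ψ (x - y)) x := by
    have hm : ∀ {F : Type _} [NormedAddCommGroup F] (g : Euc n → F) (_ : Continuous g) (x : Euc n),
        AEStronglyMeasurable (fun y => g (x - y)) (volume.restrict (cell q)) := fun g hg x =>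
      (hg.comp (by fun_prop : Continuous fun y => x - y)).aestronglyMeasurable
    refine hasFDerivAt_integral_of_dominated_of_fderiv_le (𝕜 := ℝ)
      (F := fun x y => h y * ψ (x - y)) (F' := fun x y => h y • fderiv ℝ ψ (x - y))
      (bound := fun y => ‖h y‖ * M) (Metric.ball_mem_nhds x one_pos) ?_ ?_ ?_ ?_ ?_ ?_
    · exact Eventually.of_forall fun x => hi.1.mul (hm ψ hψ.continuous x)
    · obtain ⟨M', hM'⟩ := hcomp.exists_bound_of_continuousOn hψ.continuous.continuousOn
      refine Integrable.mono' (hi.norm.mul_const M') (hi.1.mul (hm ψ hψ.continuous x)) ?_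
      filter_upwards [ae_restrict_mem isOpen_cell.measurableSet] with y hy
      rw [norm_mul]
      gcongr
      refine hM' _ ?_
      have := hR hy
      rw [mem_closedBall_zero_iff] at this ⊢
      linarith [norm_sub_le x y]
    · exact hi.1.smul (hm _ (hψ.continuous_fderiv one_ne_zero) x)
    · filter_upwards [ae_restrict_mem isOpen_cell.measurableSet] with y hy t ht
      rw [norm_smul]
      gcongr
      refine hM _ ?_
      have := hR hy
      rw [mem_closedBall_zero_iff] at this ⊢
      have h2 : ‖t - x‖ < 1 := by simpa [dist_eq_norm] using ht
      have h3 : ‖t - y‖ ≤ ‖t - x‖ + ‖x‖ + ‖y‖ := by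
        calc ‖t - y‖ = ‖(t - x) + x - y‖ := by congr 1; abel
          _ ≤ _ := (norm_sub_le _ _).trans (add_le_add_left (norm_add_le _ _) _)
      linarith
    · exact hi.norm.mul_const M
    · refine Eventually.of_forall fun y t _ => ?_
      have := ((hψ.differentiable one_ne_zero) (t - y)).hasFDerivAt
      exact ((hasFDerivAt_comp_sub y).2 this).const_mul (h y)
  have hfun : (fun x => ∫ y in cell q, h (x - y) * ψ y) =
      fun x => ∫ y in cell q, h y * ψ (x - y) := funext (key hψp)
  have hψp' : ∀ j x z, partialD j ψ (x + latPt q z) = partialD j ψ x := fun j x z =>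
    PeriodicOn.foldr (S := univ) isOpen_univ (fun y _ => hψp y) [j] x (mem_univ x) z
  rw [hfun]
  refine ⟨hd.differentiableAt, fun j => ?_⟩
  rw [key (hψp' j), partialD, hd.fderiv, ContinuousLinearMap.integral_apply]
  · rfl
  · obtain ⟨M', hM'⟩ := hcomp.exists_bound_of_continuousOn hψ.continuous.continuousOn
    refine Integrable.mono' (hi.norm.mul_const M) (hi.1.smul
      ((hψ.continuous_fderiv one_ne_zero).comp
        (by fun_prop : Continuous fun y => x - y)).aestronglyMeasurable) ?_
    filter_upwards [ae_restrict_mem isOpen_cell.measurableSet] with y hy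
    rw [norm_smul]
    gcongr
    refine hM _ ?_
    have := hR hy
    rw [mem_closedBall_zero_iff] at this ⊢
    linarith [norm_sub_le x y]

/-- The derivatives of a convolution fall on the kernel where the kernel is smooth. -/
lemma partialD_setConv {G C N U : Set (Euc n)} (hC : IsCompact C) (hCG : C ⊆ G) (hU : IsOpen U)
    (hN : MeasurableSet N) (hNv : volume N ≠ ⊤) (hsub : ∀ x ∈ U, ∀ y ∈ N, x - y ∈ C)
    {k w : Euc n → 𝕜} (hk : ∀ x ∈ G, ContDiffAt ℝ ∞ k x)
    (hw : AEStronglyMeasurable w (volume.restrict N)) {M : ℝ} (hM : ∀ y ∈ N, ‖w y‖ ≤ M)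
    {x : Euc n} (hx : x ∈ U) :
    DifferentiableAt ℝ (fun x => ∫ y in N, k (x - y) * w y) x ∧
      ∀ j, partialD j (fun x => ∫ y in N, k (x - y) * w y) x =
        ∫ y in N, partialD j k (x - y) * w y := by
  have hk' : ∀ x ∈ C, ContinuousAt (fderiv ℝ k) x := fun x hx =>
    ((hk x (hCG hx)).fderiv_right (m := 0) (by simp)).continuousAt
  obtain ⟨B, hB⟩ := hC.exists_bound_of_continuousOn fun x hx => (hk' x hx).continuousWithinAt
  obtain ⟨B', hB'⟩ := hC.exists_bound_of_continuousOn fun x hx =>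
    (hk x (hCG hx)).continuousAt.continuousWithinAt
  have hm : ∀ x ∈ U, AEStronglyMeasurable (fun y => w y * k (x - y)) (volume.restrict N) :=
    fun x hx => hw.mul (ContinuousOn.aestronglyMeasurable (fun y hy =>
      ((hk _ (hCG (hsub x hx y hy))).continuousAt.comp (f := fun y => x - y)
        (by fun_prop)).continuousWithinAt) hN)
  have hm' : AEStronglyMeasurable (fun y => w y • fderiv ℝ k (x - y)) (volume.restrict N) :=
    hw.smul (ContinuousOn.aestronglyMeasurable (fun y hy =>
      ((hk' _ (hsub x hx y hy)).comp (f := fun y => x - y)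
        (by fun_prop)).continuousWithinAt) hN)
  have hfin : IsFiniteMeasure (volume.restrict N) := ⟨by simpa using hNv.lt_top⟩
  have hbd : ∀ x ∈ U, ∀ᵐ y ∂(volume.restrict N), ‖w y • fderiv ℝ k (x - y)‖ ≤ M * B := by
    intro x hx
    filter_upwards [ae_restrict_mem hN] with y hy
    rw [norm_smul]
    exact mul_le_mul (hM y hy) (hB _ (hsub x hx y hy)) (norm_nonneg _)
      ((norm_nonneg _).trans (hM y hy))
  have hd : HasFDerivAt (fun x => ∫ y in N, w y * k (x - y))
      (∫ y in N, w y • fderiv ℝ k (x - y)) x := by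
    refine hasFDerivAt_integral_of_dominated_of_fderiv_le (𝕜 := ℝ)
      (F := fun x y => w y * k (x - y)) (F' := fun x y => w y • fderiv ℝ k (x - y))
      (bound := fun y => M * B) (hU.mem_nhds hx) ?_ ?_ hm' ?_ (integrable_const _) ?_
    · filter_upwards [hU.mem_nhds hx] with t ht using hm t ht
    · refine Integrable.mono' (integrable_const (M * B')) (hm x hx) ?_
      filter_upwards [ae_restrict_mem hN] with y hy
      rw [norm_mul]
      exact mul_le_mul (hM y hy) (hB' _ (hsub x hx y hy)) (norm_nonneg _)
        ((norm_nonneg _).trans (hM y hy))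
    · filter_upwards [ae_restrict_mem hN] with y hy t ht
      rw [norm_smul]
      exact mul_le_mul (hM y hy) (hB _ (hsub t ht y hy)) (norm_nonneg _)
        ((norm_nonneg _).trans (hM y hy))
    · filter_upwards [ae_restrict_mem hN] with y hy t ht
      have := ((hk _ (hCG (hsub t ht y hy))).differentiableAt (by simp)).hasFDerivAt
      exact ((hasFDerivAt_comp_sub y).2 this).const_mul (w y)
  simp only [mul_comm _ (w _)]
  refine ⟨hd.differentiableAt, fun j => ?_⟩
  rw [partialD, hd.fderiv, ContinuousLinearMap.integral_apply]
  · rfl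
  · exact Integrable.mono' (integrable_const (M * B)) hm' (hbd x hx)

end Differentiation


/-! ### The derivatives of a potential -/

section Core

variable {𝕜 : Type*} [RCLike 𝕜] {n : ℕ} {q : Fin n → ℝ}

/-- A smooth periodic cutoff function, supported in `S`, which is locally equal to `1` at the
points of `S ∩ Q` outside of `N`. -/
structure IsCutoff (q : Fin n → ℝ) (S N : Set (Euc n)) (χ : Euc n → 𝕜) : Prop where
  contDiff : ContDiff ℝ ∞ χ
  periodic : ∀ x z, χ (x + latPt q z) = χ x
  tsupport_subset : tsupport χ ⊆ S
  eventually_eq_one : ∀ y ∈ S ∩ cell q, y ∉ N → χ =ᶠ[𝓝 y] 1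
  norm_le_one : ∀ y, ‖χ y‖ ≤ 1

lemma contDiff_partialD {χ : Euc n → 𝕜} (hχ : ContDiff ℝ ∞ χ) (j : Fin n) :
    ContDiff ℝ ∞ (partialD j χ) :=
  contDiff_iff_contDiffAt.2 fun _ => contDiffAt_partialD j hχ.contDiffAt

lemma tsupport_partialD_subset (j : Fin n) (χ : Euc n → 𝕜) :
    tsupport (partialD j χ) ⊆ tsupport χ := by
  refine closure_minimal (fun x hx => ?_) (isClosed_tsupport χ)
  by_contra h
  refine hx ?_
  have h1 := (partialD_congr j (notMem_tsupport_iff_eventuallyEq.1 h)).self_of_nhds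
  simpa [partialD] using h1

/-- Off the closed support of `χ` the product vanishes locally, whatever `g` is there. -/
lemma contDiff_mul_of_tsupport_subset {S : Set (Euc n)} {χ g : Euc n → 𝕜} (hχ : ContDiff ℝ ∞ χ)
    (hs : tsupport χ ⊆ S) (hg : ∀ x ∈ S, ContDiffAt ℝ ∞ g x) : ContDiff ℝ ∞ (χ * g) := by
  refine contDiff_iff_contDiffAt.2 fun x => ?_
  by_cases hx : x ∈ tsupport χ
  · exact hχ.contDiffAt.mul (hg x (hs hx))
  · refine (contDiffAt_const (c := (0 : 𝕜))).congr_of_eventuallyEq ?_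
    filter_upwards [notMem_tsupport_iff_eventuallyEq.1 hx] with y hy
    simp [hy]

/-- The product rule holds even at points where `g` is not differentiable, since `χ` and its
derivative vanish there. -/
lemma partialD_mul_of_tsupport_subset {S : Set (Euc n)} {χ g : Euc n → 𝕜} (hχ : ContDiff ℝ ∞ χ)
    (hs : tsupport χ ⊆ S) (hg : ∀ x ∈ S, ContDiffAt ℝ ∞ g x) (j : Fin n) :
    partialD j (χ * g) = χ * partialD j g + partialD j χ * g := by
  ext x
  by_cases hx : x ∈ tsupport χ
  · exact partialD_mul j (hχ.contDiffAt.differentiableAt (by simp))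
      ((hg x (hs hx)).differentiableAt (by simp))
  · have h0 := notMem_tsupport_iff_eventuallyEq.1 hx
    have h1 : χ * g =ᶠ[𝓝 x] 0 := by
      filter_upwards [h0] with y hy
      simp [hy]
    have h2 := (partialD_congr j h1).self_of_nhds
    have h3 := image_eq_zero_of_notMem_tsupport
      (fun h => hx (tsupport_partialD_subset j χ h) : x ∉ tsupport (partialD j χ))
    rw [h2, Pi.add_apply, Pi.mul_apply, Pi.mul_apply, h3, h0.self_of_nhds]
    simp [partialD]

lemma integrableOn_cell_mul (hq : ∀ j, 0 < q j) {h ψ : Euc n → 𝕜} (hi : IntegrableOn h (cell q))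
    (hh : ∀ x z, h (x + latPt q z) = h x) {D : Set (Euc n)} (hD : MeasurableSet D)
    (hDq : D ⊆ cell q) (hψ : ContinuousOn ψ D) {M : ℝ} (hM : ∀ y ∈ D, ‖ψ y‖ ≤ M) (x : Euc n) :
    IntegrableOn (fun y => h (x - y) * ψ y) D := by
  have h1 := (integrableOn_cell_sub_left hq x hh hi).mono_set hDq
  refine Integrable.mono' (h1.norm.mul_const M) (h1.1.mul (hψ.aestronglyMeasurable hD)) ?_
  filter_upwards [ae_restrict_mem hD] with y hy
  rw [norm_mul]
  gcongr
  exact hM y hy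

lemma exists_bound_on_cell {ψ : Euc n → 𝕜} (hψ : Continuous ψ) :
    ∃ M, ∀ y ∈ cell q, ‖ψ y‖ ≤ M := by
  obtain ⟨M, hM⟩ := (isBounded_cell (q := q)).isCompact_closure.exists_bound_of_continuousOn
    hψ.continuousOn
  exact ⟨M, fun y hy => hM y (subset_closure hy)⟩

/-- Of `m = k + r + 1` derivatives, `k` act on the kernel, `r` on the density and one on the cutoff.
Since `k! r! ≤ (m - 1)! = m! / m`, a factor `1 / m` is gained, which pays for summing `m` such
terms. -/
lemma factorial_div_pow_mul_le {ρ : ℝ} (hρ : 0 < ρ) (k r : ℕ) :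
    ((k.factorial : ℝ) / ρ ^ k) * (r.factorial / ρ ^ r) ≤
      ρ * (((k + r + 1).factorial / ρ ^ (k + r + 1)) / (k + r + 1 : ℕ)) := by
  have h1 : (k.factorial : ℝ) * r.factorial ≤ (k + r).factorial := by
    exact_mod_cast Nat.le_of_dvd (Nat.factorial_pos _)
      (Nat.factorial_mul_factorial_dvd_factorial_add k r)
  have h2 : ρ * (((k + r + 1).factorial / ρ ^ (k + r + 1)) / (k + r + 1 : ℕ)) =
      (k + r).factorial / ρ ^ (k + r) := by
    rw [Nat.factorial_succ]
    push_cast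
    field_simp
    ring
  rw [h2, div_mul_div_comm, ← pow_add]
  gcongr

/-- The data for which the derivatives of the potential are computed: a periodic open set `S`, a
density `f` on `S`, a kernel `h`, a cutoff `χ` and a set `N` such that `h` is smooth on the
differences of the points of `U` and the points of `N ∩ S ∩ Q`. -/
structure PotentialData (q : Fin n → ℝ) (S N U C : Set (Euc n)) (ρ Mf Mh : ℝ)
    (χ f h : Euc n → 𝕜) : Prop where
  pos : ∀ j, 0 < q j
  rho_pos : 0 < ρ
  density_bound_nonneg : 0 ≤ Mf
  kernel_bound_nonneg : 0 ≤ Mh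
  isOpen_S : IsOpen S
  measurableSet_N : MeasurableSet N
  isOpen_U : IsOpen U
  isCompact_C : IsCompact C
  sub_mem : ∀ x ∈ U, ∀ y ∈ S ∩ cell q ∩ N, x - y ∈ C
  cutoff : IsCutoff q S N χ
  density_smooth : ∀ x ∈ S, ContDiffAt ℝ ∞ f x
  density_periodic : PeriodicOn q S f
  density_bound : ∀ L : List (Fin n), ∀ y ∈ S ∩ cell q,
    ‖L.foldr partialD f y‖ ≤ Mf * (L.length.factorial / ρ ^ L.length)
  kernel_integrable : IntegrableOn h (cell q)
  kernel_periodic : ∀ x z, h (x + latPt q z) = h x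
  kernel_smooth : ∀ x ∈ C, ContDiffAt ℝ ∞ h x
  kernel_bound : ∀ L : List (Fin n), ∀ x ∈ C,
    ‖L.foldr partialD h x‖ ≤ Mh * (L.length.factorial / ρ ^ L.length)

namespace PotentialData

variable {S N U C : Set (Euc n)} {ρ Mf Mh : ℝ} {χ f h : Euc n → 𝕜}

lemma measurableSet_inter (d : PotentialData q S N U C ρ Mf Mh χ f h) :
    MeasurableSet (S ∩ cell q ∩ N) :=
  (d.isOpen_S.measurableSet.inter isOpen_cell.measurableSet).inter d.measurableSet_N

lemma volume_inter_ne_top (S N : Set (Euc n)) : volume (S ∩ cell q ∩ N) ≠ ⊤ :=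
  ((isBounded_cell (q := q)).subset fun _ hx => hx.1.2).measure_lt_top.ne

lemma density_foldr_smooth (d : PotentialData q S N U C ρ Mf Mh χ f h) (L : List (Fin n)) :
    ∀ x ∈ S, ContDiffAt ℝ ∞ (L.foldr partialD f) x :=
  fun x hx => contDiffAt_foldr L (d.density_smooth x hx)

lemma aestronglyMeasurable_mul (d : PotentialData q S N U C ρ Mf Mh χ f h) {η : Euc n → 𝕜}
    (hη : Continuous η) (L : List (Fin n)) :
    AEStronglyMeasurable (η * L.foldr partialD f) (volume.restrict (S ∩ cell q ∩ N)) := by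
  refine ContinuousOn.aestronglyMeasurable (fun x hx => ?_) d.measurableSet_inter
  exact (hη.continuousAt.mul (d.density_foldr_smooth L x hx.1.1).continuousAt).continuousWithinAt

lemma norm_mul_le (d : PotentialData q S N U C ρ Mf Mh χ f h) {η : Euc n → 𝕜} {c : ℝ}
    (hη : ∀ y ∈ cell q, ‖η y‖ ≤ c) (L : List (Fin n)) :
    ∀ y ∈ S ∩ cell q ∩ N, ‖(η * L.foldr partialD f) y‖ ≤
      c * (Mf * (L.length.factorial / ρ ^ L.length)) := fun y hy => by
  rw [Pi.mul_apply, norm_mul]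
  exact mul_le_mul (hη y hy.1.2) (d.density_bound L y hy.1) (norm_nonneg _)
    ((norm_nonneg _).trans (hη y hy.1.2))

/-- The derivatives of a boundary term. -/
lemma partialD_boundaryTerm (d : PotentialData q S N U C ρ Mf Mh χ f h) {η : Euc n → 𝕜}
    (hη : Continuous η) (L A : List (Fin n)) {x : Euc n} (hx : x ∈ U) :
    DifferentiableAt ℝ (fun x => ∫ y in S ∩ cell q ∩ N,
        A.foldr partialD h (x - y) * (η * L.foldr partialD f) y) x ∧
      ∀ j, partialD j (fun x => ∫ y in S ∩ cell q ∩ N,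
        A.foldr partialD h (x - y) * (η * L.foldr partialD f) y) x =
        ∫ y in S ∩ cell q ∩ N,
          (j :: A).foldr partialD h (x - y) * (η * L.foldr partialD f) y := by
  obtain ⟨c, hc⟩ := exists_bound_on_cell (q := q) hη
  exact partialD_setConv d.isCompact_C subset_rfl d.isOpen_U d.measurableSet_inter
    (volume_inter_ne_top S N) d.sub_mem
    (fun x hx => contDiffAt_foldr A (d.kernel_smooth x hx)) (d.aestronglyMeasurable_mul hη L)
    (d.norm_mul_le hc L) hx

lemma norm_boundaryTerm_le (d : PotentialData q S N U C ρ Mf Mh χ f h) {η : Euc n → 𝕜} {c : ℝ}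
    (hc : 0 ≤ c) (hη : ∀ y ∈ cell q, ‖η y‖ ≤ c) (L A : List (Fin n)) {x : Euc n} (hx : x ∈ U) :
    ‖∫ y in S ∩ cell q ∩ N, A.foldr partialD h (x - y) * (η * L.foldr partialD f) y‖ ≤
      (Mh * (A.length.factorial / ρ ^ A.length)) *
        (c * (Mf * (L.length.factorial / ρ ^ L.length))) * volume.real (cell q) := by
  have hρ := d.rho_pos
  have hMf := d.density_bound_nonneg
  have hMh := d.kernel_bound_nonneg
  have h1 := norm_setIntegral_le_of_norm_le_const (μ := volume)
    (volume_inter_ne_top (q := q) S N).lt_top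
    (f := fun y => A.foldr partialD h (x - y) * (η * L.foldr partialD f) y)
    (C := (Mh * (A.length.factorial / ρ ^ A.length)) *
        (c * (Mf * (L.length.factorial / ρ ^ L.length)))) fun y hy => by
      rw [norm_mul]
      exact mul_le_mul (d.kernel_bound A _ (d.sub_mem x hx y hy)) (d.norm_mul_le hη L y hy)
        (norm_nonneg _) ((norm_nonneg _).trans (d.kernel_bound A _ (d.sub_mem x hx y hy)))
  refine h1.trans (mul_le_mul_of_nonneg_left ?_ ?_)
  · exact measureReal_mono (fun y hy => hy.1.2) isBounded_cell.measure_lt_top.ne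
  · positivity

lemma continuous_mul (d : PotentialData q S N U C ρ Mf Mh χ f h) {η : Euc n → 𝕜}
    (hη : ContDiff ℝ ∞ η) (hs : tsupport η ⊆ S) (L : List (Fin n)) :
    Continuous (η * L.foldr partialD f) :=
  (contDiff_mul_of_tsupport_subset hη hs (d.density_foldr_smooth L)).continuous

lemma integrableOn_mul (d : PotentialData q S N U C ρ Mf Mh χ f h) {ψ : Euc n → 𝕜}
    (hψ : Continuous ψ) (x : Euc n) : IntegrableOn (fun y => h (x - y) * ψ y) (cell q) := by
  obtain ⟨M, hM⟩ := exists_bound_on_cell (q := q) hψ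
  exact integrableOn_cell_mul d.pos d.kernel_integrable d.kernel_periodic
    isOpen_cell.measurableSet subset_rfl hψ.continuousOn hM x

/-- The cutoff is locally constant at such points: 1 in `S` off `N`, and 0 outside `S`. Hence
integrals containing its derivatives only see `N`, where the kernel is smooth. -/
lemma partialD_cutoff_eq_zero (d : PotentialData q S N U C ρ Mf Mh χ f h) (j : Fin n)
    {y : Euc n} (hy : y ∈ cell q \ (S ∩ cell q ∩ N)) : partialD j χ y = 0 := by
  by_cases hyS : y ∈ S
  · have h1 := (partialD_congr j (d.cutoff.eventually_eq_one y ⟨hyS, hy.1⟩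
      fun h => hy.2 ⟨⟨hyS, hy.1⟩, h⟩)).self_of_nhds
    rw [h1]
    simp [partialD, Pi.one_def]
  · exact image_eq_zero_of_notMem_tsupport
      fun h => hyS (d.cutoff.tsupport_subset (tsupport_partialD_subset j χ h))

/-- The derivative of the term which carries the singularity of the kernel. -/
lemma partialD_mainTerm (d : PotentialData q S N U C ρ Mf Mh χ f h) (L : List (Fin n))
    (x : Euc n) :
    DifferentiableAt ℝ (fun x => ∫ y in cell q, h (x - y) * (χ * L.foldr partialD f) y) x ∧
      ∀ j, partialD j (fun x => ∫ y in cell q, h (x - y) * (χ * L.foldr partialD f) y) x =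
        (∫ y in cell q, h (x - y) * (χ * (j :: L).foldr partialD f) y) +
        ∫ y in S ∩ cell q ∩ N, h (x - y) * (partialD j χ * L.foldr partialD f) y := by
  have hsm := d.density_foldr_smooth L
  -- The density is periodic on `S` only; elsewhere the periodic factor `χ` vanishes.
  have hper : ∀ x z, (χ * L.foldr partialD f) (x + latPt q z) = (χ * L.foldr partialD f) x := by
    intro x z
    simp only [Pi.mul_apply, d.cutoff.periodic]
    by_cases hx : x ∈ S
    · rw [d.density_periodic.foldr d.isOpen_S L x hx z]
    · rw [image_eq_zero_of_notMem_tsupport fun h => hx (d.cutoff.tsupport_subset h)]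
      simp
  have h1 := partialD_cellConv d.pos d.kernel_integrable d.kernel_periodic
    ((contDiff_mul_of_tsupport_subset d.cutoff.contDiff d.cutoff.tsupport_subset hsm).of_le
      (by simp)) hper x
  refine ⟨h1.1, fun j => ?_⟩
  rw [h1.2 j, partialD_mul_of_tsupport_subset d.cutoff.contDiff d.cutoff.tsupport_subset hsm j]
  have h2 := d.integrableOn_mul
    (d.continuous_mul d.cutoff.contDiff d.cutoff.tsupport_subset (j :: L)) x
  have h3 := d.integrableOn_mul (d.continuous_mul (contDiff_partialD d.cutoff.contDiff j)
    ((tsupport_partialD_subset j χ).trans d.cutoff.tsupport_subset) L) x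
  have h4 : ∫ y in S ∩ cell q ∩ N, h (x - y) * (partialD j χ * L.foldr partialD f) y =
      ∫ y in cell q, h (x - y) * (partialD j χ * L.foldr partialD f) y := by
    symm
    refine setIntegral_eq_of_subset_of_forall_sdiff_eq_zero isOpen_cell.measurableSet
      (fun y hy => hy.1.2) fun y hy => ?_
    simp [d.partialD_cutoff_eq_zero j hy]
  rw [h4, ← integral_add h2 h3]
  refine integral_congr_ae (Eventually.of_forall fun y => ?_)
  simp [mul_add]

lemma integrableOn_potential (d : PotentialData q S N U C ρ Mf Mh χ f h) (x : Euc n) :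
    IntegrableOn (fun y => h (x - y) * f y) (S ∩ cell q) :=
  integrableOn_cell_mul d.pos d.kernel_integrable d.kernel_periodic
    (d.isOpen_S.measurableSet.inter isOpen_cell.measurableSet) inter_subset_right
    (fun y hy => (d.density_smooth y hy.1).continuousAt.continuousWithinAt)
    (fun y hy => d.density_bound [] y hy) x

/-- Splitting of the potential by the cutoff. -/
lemma potential_eq (d : PotentialData q S N U C ρ Mf Mh χ f h) (x : Euc n) :
    ∫ y in S ∩ cell q, h (x - y) * f y =
      (∫ y in cell q, h (x - y) * (χ * f) y) +
        ∫ y in S ∩ cell q ∩ N, h (x - y) * ((1 - χ) * f) y := by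
  have hDm := d.isOpen_S.measurableSet.inter (isOpen_cell (q := q)).measurableSet
  have h1 : ∫ y in cell q, h (x - y) * (χ * f) y = ∫ y in S ∩ cell q, h (x - y) * (χ * f) y := by
    refine setIntegral_eq_of_subset_of_forall_sdiff_eq_zero isOpen_cell.measurableSet
      inter_subset_right fun y hy => ?_
    rw [Pi.mul_apply, image_eq_zero_of_notMem_tsupport
      fun h => hy.2 ⟨d.cutoff.tsupport_subset h, hy.1⟩]
    simp
  have h2 : ∫ y in S ∩ cell q, h (x - y) * ((1 - χ) * f) y =
      ∫ y in S ∩ cell q ∩ N, h (x - y) * ((1 - χ) * f) y := by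
    refine setIntegral_eq_of_subset_of_forall_sdiff_eq_zero hDm inter_subset_left fun y hy => ?_
    have := (d.cutoff.eventually_eq_one y hy.1 fun h => hy.2 ⟨hy.1, h⟩).self_of_nhds
    simp [this]
  have h3 : IntegrableOn (fun y => h (x - y) * (χ * f) y) (S ∩ cell q) := (d.integrableOn_mul
    (d.continuous_mul d.cutoff.contDiff d.cutoff.tsupport_subset []) x).mono_set
    (inter_subset_right (s := S))
  have h4 : IntegrableOn (fun y => h (x - y) * f y - h (x - y) * (χ * f) y) (S ∩ cell q) :=
    (d.integrableOn_potential x).sub h3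
  have h5 : ∫ y in S ∩ cell q, h (x - y) * f y - h (x - y) * (χ * f) y =
      ∫ y in S ∩ cell q, h (x - y) * ((1 - χ) * f) y :=
    integral_congr_ae (Eventually.of_forall fun y => by simp; ring)
  rw [h1, ← h2, ← h5, ← integral_add h3 h4]
  exact integral_congr_ae (Eventually.of_forall fun y => by simp)

/-- The derivatives of a potential: each one of them is the potential of a derivative of the
density plus integrals in which the kernel is smooth. -/
lemma foldr_potential (d : PotentialData q S N U C ρ Mf Mh χ f h) (L : List (Fin n)) :
    ∀ x ∈ U, L.foldr partialD (fun x => ∫ y in S ∩ cell q, h (x - y) * f y) x =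
      ((∫ y in cell q, h (x - y) * (χ * L.foldr partialD f) y) +
        ∫ y in S ∩ cell q ∩ N, L.foldr partialD h (x - y) * ((1 - χ) * f) y) +
      ∑ k : Fin L.length, ∫ y in S ∩ cell q ∩ N, (L.take k).foldr partialD h (x - y) *
        (partialD (L.get k) χ * (L.drop (k + 1)).foldr partialD f) y := by
  induction L with
  | nil => intro x _; simpa using d.potential_eq x
  | cons j L ih =>
    intro x hx
    have hc1 : Continuous (1 - χ) := continuous_const.sub d.cutoff.contDiff.continuous
    -- The induction hypothesis holds on the open set `U`, so its two sides have the same derivative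
    -- at `x`.
    have hev := partialD_congr j (f := L.foldr partialD fun x => ∫ y in S ∩ cell q, h (x - y) * f y)
      (g := (fun x => ∫ y in cell q, h (x - y) * (χ * L.foldr partialD f) y) +
        (fun x => ∫ y in S ∩ cell q ∩ N, L.foldr partialD h (x - y) * ((1 - χ) * f) y) +
        fun x => ∑ k : Fin L.length, ∫ y in S ∩ cell q ∩ N, (L.take k).foldr partialD h (x - y) *
        (partialD (L.get k) χ * (L.drop (k + 1)).foldr partialD f) y) (x := x) (by
        filter_upwards [d.isOpen_U.mem_nhds hx] with y hy using ih y hy)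
    have e1 := d.partialD_mainTerm L x
    have e2 := d.partialD_boundaryTerm hc1 [] L hx
    simp only [List.foldr_nil] at e2
    have e3 := fun k : Fin L.length => d.partialD_boundaryTerm
      (contDiff_partialD d.cutoff.contDiff (L.get k)).continuous (L.drop (k + 1)) (L.take k) hx
    have e4 : partialD j (fun x => ∑ k : Fin L.length, ∫ y in S ∩ cell q ∩ N,
        (L.take k).foldr partialD h (x - y) *
        (partialD (L.get k) χ * (L.drop (k + 1)).foldr partialD f) y) x =
        ∑ k : Fin L.length, ∫ y in S ∩ cell q ∩ N, (j :: L.take k).foldr partialD h (x - y) *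
        (partialD (L.get k) χ * (L.drop (k + 1)).foldr partialD f) y := by
      rw [partialD, fderiv_fun_sum fun k _ => (e3 k).1, sum_apply]
      exact Finset.sum_congr rfl fun k _ => (e3 k).2 j
    rw [List.foldr_cons, hev.self_of_nhds, partialD_add j (e1.1.add e2.1)
      (DifferentiableAt.fun_sum (u := Finset.univ) fun k _ => (e3 k).1), partialD_add j e1.1 e2.1,
      e1.2 j, e4]
    -- The summand `k = 0` is the new boundary term, produced by the main term with `∂_j χ`. The old
    -- summands move up by one index and receive `j` on the kernel.
    have e5 := Fin.sum_univ_succ (n := L.length) fun k : Fin (j :: L).length =>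
      ∫ y in S ∩ cell q ∩ N, ((j :: L).take k).foldr partialD h (x - y) *
        (partialD ((j :: L).get k) χ * ((j :: L).drop (k + 1)).foldr partialD f) y
    rw [e2.2 j]
    refine Eq.trans ?_ (congrArg _ e5.symm)
    simp only [List.foldr_cons, List.get_eq_getElem, Fin.val_zero, Fin.val_succ, List.take_zero,
      List.foldr_nil, List.take_succ_cons, List.drop_succ_cons, List.getElem_cons_succ,
      List.getElem_cons_zero, List.drop_zero, zero_add]
    ring

/-- By `foldr_potential` every iterated partial derivative agrees near `x` with a sum of
differentiable functions. -/
lemma contDiffOn_potential (d : PotentialData q S N U C ρ Mf Mh χ f h) :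
    ContDiffOn ℝ ∞ (fun x => ∫ y in S ∩ cell q, h (x - y) * f y) U := by
  refine contDiffOn_of_foldr_partialD d.isOpen_U fun L x hx => ?_
  refine DifferentiableAt.differentiableWithinAt ?_
  have hc1 : Continuous (1 - χ) := continuous_const.sub d.cutoff.contDiff.continuous
  refine DifferentiableAt.congr_of_eventuallyEq (((d.partialD_mainTerm L x).1.add
    (d.partialD_boundaryTerm hc1 [] L hx).1).add (DifferentiableAt.fun_sum
      (u := Finset.univ) fun k _ => (d.partialD_boundaryTerm
        (contDiff_partialD d.cutoff.contDiff (L.get k)).continuous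
        (L.drop (k + 1)) (L.take k) hx).1)) ?_
  filter_upwards [d.isOpen_U.mem_nhds hx] with y hy using d.foldr_potential L y hy

/-- The three summands of the constant bound the main term, the integral with `1 - χ` (where `|1 -
χ| ≤ 2`) and the sum of the terms with a derivative of `χ`. -/
lemma norm_foldr_potential_le (d : PotentialData q S N U C ρ Mf Mh χ f h)
    {c : ℝ} (hc0 : 0 ≤ c) (hc : ∀ j, ∀ y ∈ cell q, ‖partialD j χ y‖ ≤ c) (L : List (Fin n))
    {x : Euc n} (hx : x ∈ U) :
    ‖L.foldr partialD (fun x => ∫ y in S ∩ cell q, h (x - y) * f y) x‖ ≤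
      ((∫ y in cell q, ‖h y‖) * Mf + 2 * volume.real (cell q) * (Mh * Mf) +
        ρ * c * volume.real (cell q) * (Mh * Mf)) * (L.length.factorial / ρ ^ L.length) := by
  have hρ := d.rho_pos
  have hMf := d.density_bound_nonneg
  have hMh := d.kernel_bound_nonneg
  set R : ℝ := L.length.factorial / ρ ^ L.length with hR
  have hR0 : 0 ≤ R := by positivity
  rw [d.foldr_potential L x hx]
  have b1 : ‖∫ y in cell q, h (x - y) * (χ * L.foldr partialD f) y‖ ≤
      (∫ y in cell q, ‖h y‖) * Mf * R := by
    have hi := integrableOn_cell_sub_left d.pos x d.kernel_periodic d.kernel_integrable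
    have h1 := setIntegral_cell_sub_left d.pos x (f := fun y => ‖h y‖)
      (fun x z => by rw [d.kernel_periodic])
    rw [← h1, mul_assoc, ← integral_mul_const]
    refine norm_integral_le_of_norm_le (hi.norm.mul_const _) ?_
    filter_upwards [ae_restrict_mem isOpen_cell.measurableSet] with y hy
    rw [norm_mul, Pi.mul_apply]
    gcongr
    by_cases hyS : y ∈ S
    · rw [norm_mul]
      calc _ ≤ 1 * (Mf * R) := mul_le_mul (d.cutoff.norm_le_one y)
            (d.density_bound L y ⟨hyS, hy⟩) (norm_nonneg _) zero_le_one
        _ = Mf * R := one_mul _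
    · rw [image_eq_zero_of_notMem_tsupport fun h => hyS (d.cutoff.tsupport_subset h)]
      simp only [zero_mul, norm_zero]
      positivity
  have b2 : ‖∫ y in S ∩ cell q ∩ N, L.foldr partialD h (x - y) * ((1 - χ) * f) y‖ ≤
      2 * volume.real (cell q) * (Mh * Mf) * R := by
    have h2 := d.norm_boundaryTerm_le (η := 1 - χ) zero_le_two (fun y _ => by
      refine (norm_sub_le _ _).trans ?_
      have := d.cutoff.norm_le_one y
      simp only [Pi.one_apply, norm_one]
      linarith) [] L hx
    refine h2.trans (le_of_eq ?_)
    simp [← hR]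
    ring
  have b3 : ∀ k : Fin L.length, ‖∫ y in S ∩ cell q ∩ N, (L.take k).foldr partialD h (x - y) *
        (partialD (L.get k) χ * (L.drop (k + 1)).foldr partialD f) y‖ ≤
      ρ * c * volume.real (cell q) * (Mh * Mf) * (R / L.length) := by
    intro k
    have h3 := d.norm_boundaryTerm_le hc0 (hc (L.get k)) (L.drop (k + 1)) (L.take k) hx
    obtain ⟨r, hr⟩ : ∃ r, L.length = k + r + 1 := ⟨L.length - (k + 1), by omega⟩
    have hl1 : (L.take k).length = k := by simp [hr, add_assoc]
    have hl2 : (L.drop (k + 1)).length = r := by simp [hr]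
    rw [hl1, hl2] at h3
    have h4 := factorial_div_pow_mul_le hρ k r
    rw [← hr, ← hR] at h4
    calc _ ≤ _ := h3
      _ = Mh * c * Mf * volume.real (cell q) *
          (((k : ℕ).factorial / ρ ^ (k : ℕ)) * (r.factorial / ρ ^ r)) := by ring
      _ ≤ Mh * c * Mf * volume.real (cell q) * (ρ * (R / L.length)) := by gcongr
      _ = _ := by ring
  have b4 := (norm_sum_le Finset.univ fun k : Fin L.length => ∫ y in S ∩ cell q ∩ N,
    (L.take k).foldr partialD h (x - y) *
      (partialD (L.get k) χ * (L.drop (k + 1)).foldr partialD f) y).trans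
        (Finset.sum_le_sum fun k _ => b3 k)
  rw [Finset.sum_const, Finset.card_univ, Fintype.card_fin, nsmul_eq_mul] at b4
  -- Only an inequality: for the empty list the quotient by the length is zero.
  have b5 : (L.length : ℝ) * (ρ * c * volume.real (cell q) * (Mh * Mf) * (R / L.length)) ≤
      ρ * c * volume.real (cell q) * (Mh * Mf) * R := by
    rw [mul_left_comm]
    gcongr
    rw [mul_div_left_comm]
    exact mul_le_of_le_one_right hR0 (div_self_le_one _)
  calc _ ≤ _ := norm_add₃_le
    _ ≤ _ := add_le_add (add_le_add b1 b2) (b4.trans b5)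
    _ = _ := by ring

end PotentialData

end Core


/-! ### Periodic sets, periodic extensions and cutoff functions -/

section Periodic

variable {n : ℕ} {q : Fin n → ℝ}

lemma latPt_zero : latPt q 0 = 0 := by
  ext j; simp [latPt]

lemma mem_perSet_iff {A : Set (Euc n)} {x : Euc n} :
    x ∈ perSet q A ↔ ∃ z, x + latPt q z ∈ A := by
  simp only [perSet, mem_iUnion, mem_image]
  constructor
  · rintro ⟨z, y, hy, rfl⟩
    exact ⟨-z, by rw [latPt_neg]; simpa using hy⟩
  · rintro ⟨z, hz⟩
    exact ⟨-z, _, hz, by rw [latPt_neg]; abel⟩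

lemma perSet_mono {A B : Set (Euc n)} (h : A ⊆ B) : perSet q A ⊆ perSet q B := fun _ hx =>
  mem_perSet_iff.2 ((mem_perSet_iff.1 hx).imp fun _ hz => h hz)

lemma isOpen_perSet {A : Set (Euc n)} (hA : IsOpen A) : IsOpen (perSet q A) := by
  have : perSet q A = ⋃ z, (fun x => x + latPt q z) ⁻¹' A := by
    ext x; simp [mem_perSet_iff]
  rw [this]
  exact isOpen_iUnion fun z => hA.preimage (by fun_prop)

lemma floor_add_latPt (hq : ∀ j, 0 < q j) (x : Euc n) (z : Fin n → ℤ) (j : Fin n) :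
    ⌊(x + latPt q z) j / q j⌋ = ⌊x j / q j⌋ + z j := by
  have h : (x + latPt q z) j / q j = x j / q j + z j := by
    have := (hq j).ne'
    simp only [latPt, PiLp.add_apply]
    field_simp
  rw [h, Int.floor_add_intCast]

lemma floor_of_mem_cell {x : Euc n} (hx : x ∈ cell q) (j : Fin n) : ⌊x j / q j⌋ = 0 := by
  have h := hx j
  have hq : 0 < q j := h.1.trans h.2
  rw [Int.floor_eq_zero_iff]
  exact ⟨div_nonneg h.1.le hq.le, (div_lt_one hq).2 h.2⟩

lemma eq_zero_of_mem_cell {x : Euc n} {z : Fin n → ℤ} (hx : x ∈ cell q)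
    (hz : x + latPt q z ∈ cell q) : z = 0 := by
  funext j
  have h := floor_add_latPt (fun j => (hx j).1.trans (hx j).2) x z j
  rw [floor_of_mem_cell hx, floor_of_mem_cell hz] at h
  simpa using h.symm

lemma perSet_inter_cell {A : Set (Euc n)} (hA : A ⊆ cell q) : perSet q A ∩ cell q = A := by
  ext x
  refine ⟨fun ⟨h1, h2⟩ => ?_, fun h => ⟨subset_perSet q A h, hA h⟩⟩
  obtain ⟨z, hz⟩ := mem_perSet_iff.1 h1
  rwa [eq_zero_of_mem_cell h2 (hA hz), latPt_zero, add_zero] at hz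

/-- The cell is open and meets no other translate of `A`, so inside it the closure of the periodic
set is the closure of `A`. -/
lemma perSetExt_inter_cell {A : Set (Euc n)} (hA : A ⊆ cell q) :
    perSetExt q A ∩ cell q = cell q \ closure A := by
  ext x
  have key : x ∈ cell q → (x ∈ closure (perSet q A) ↔ x ∈ closure A) := fun hx => by
    refine ⟨fun h => ?_, fun h => closure_mono (subset_perSet q A) h⟩
    have := isOpen_cell.inter_closure ⟨hx, h⟩
    rwa [inter_comm, perSet_inter_cell hA] at this
  simp only [perSetExt, mem_inter_iff, mem_compl_iff, Set.mem_sdiff]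
  constructor
  · exact fun ⟨h1, h2⟩ => ⟨h2, fun h => h1 ((key h2).2 h)⟩
  · exact fun ⟨h1, h2⟩ => ⟨fun h => h2 ((key h1).1 h), h1⟩

lemma thickening_perSet_subset (A : Set (Euc n)) (ε : ℝ) :
    Metric.thickening ε (perSet q A) ⊆ perSet q (Metric.thickening ε A) := by
  intro x hx
  obtain ⟨y, hy, hxy⟩ := Metric.mem_thickening_iff.1 hx
  obtain ⟨z, hz⟩ := mem_perSet_iff.1 hy
  exact mem_perSet_iff.2 ⟨z, Metric.mem_thickening_iff.2 ⟨_, hz, by simpa using hxy⟩⟩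

/-- Compactness provides a margin `ε` around `closure A` inside `V`, and the same `ε` serves all
translates. -/
lemma closure_perSet_subset {A V : Set (Euc n)} (hA : IsCompact (closure A)) (hV : IsOpen V)
    (hAV : closure A ⊆ V) : closure (perSet q A) ⊆ perSet q V := by
  obtain ⟨ε, hε, h⟩ := hA.exists_thickening_subset_open hV hAV
  exact (Metric.closure_subset_thickening hε _).trans ((thickening_perSet_subset A ε).trans
    (perSet_mono ((Metric.thickening_subset_of_subset ε subset_closure).trans h)))

variable {E : Type*}

/-- The `q`-periodic function which coincides with `f` on the cell. -/
noncomputable def periodize (q : Fin n → ℝ) (f : Euc n → E) : Euc n → E :=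
  fun x => f (x + latPt q fun j => -⌊x j / q j⌋)

lemma periodize_add_latPt (hq : ∀ j, 0 < q j) (f : Euc n → E) (x : Euc n) (z : Fin n → ℤ) :
    periodize q f (x + latPt q z) = periodize q f x := by
  simp only [periodize, floor_add_latPt hq]
  rw [add_assoc, ← latPt_add]
  congr 3
  funext j
  simp

lemma periodize_of_mem_cell (f : Euc n → E) {x : Euc n} (hx : x ∈ cell q) :
    periodize q f x = f x := by
  simp only [periodize, floor_of_mem_cell hx, neg_zero]
  rw [show (fun _ : Fin n => (0 : ℤ)) = 0 from rfl, latPt_zero, add_zero]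

lemma periodize_eventuallyEq (f : Euc n → E) {x : Euc n} (hx : x ∈ cell q) :
    periodize q f =ᶠ[𝓝 x] f := by
  filter_upwards [isOpen_cell.mem_nhds hx] with y hy using periodize_of_mem_cell f hy

lemma eventually_add_latPt {p : Euc n → Prop} {x : Euc n} (z : Fin n → ℤ)
    (h : ∀ᶠ y in 𝓝 (x + latPt q z), p y) : ∀ᶠ y in 𝓝 x, p (y + latPt q z) :=
  ((by fun_prop : Continuous fun y : Euc n => y + latPt q z).tendsto x).eventually h

variable [NormedAddCommGroup E]

lemma tsupport_periodize_subset {f : Euc n → E} {W : Set (Euc n)} (hf : IsCompact (tsupport f))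
    (hW : IsOpen W) (hfW : tsupport f ⊆ W) : tsupport (periodize q f) ⊆ perSet q W := by
  obtain ⟨ε, hε, h⟩ := hf.exists_thickening_subset_open hW hfW
  have h1 : Function.support (periodize q f) ⊆ perSet q (tsupport f) := fun x hx =>
    mem_perSet_iff.2 ⟨_, subset_tsupport f hx⟩
  exact (closure_mono h1).trans ((Metric.closure_subset_thickening hε _).trans
    ((thickening_perSet_subset _ ε).trans (perSet_mono h)))

variable [NormedSpace ℝ E]

lemma contDiffAt_of_periodic {f : Euc n → E} (hf : ∀ x z, f (x + latPt q z) = f x) {x : Euc n}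
    {z : Fin n → ℤ} (h : ContDiffAt ℝ ∞ f (x + latPt q z)) : ContDiffAt ℝ ∞ f x := by
  have h1 : f = f ∘ fun y => y + latPt q z := funext fun y => (hf y z).symm
  rw [h1]
  exact ContDiffAt.comp x h (by fun_prop)

lemma contDiffAt_periodize (hq : ∀ j, 0 < q j) {f : Euc n → E} {A : Set (Euc n)}
    (hA : A ⊆ cell q) (hf : ∀ x ∈ A, ContDiffAt ℝ ∞ f x) :
    ∀ x ∈ perSet q A, ContDiffAt ℝ ∞ (periodize q f) x := by
  intro x hx
  obtain ⟨z, hz⟩ := mem_perSet_iff.1 hx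
  exact contDiffAt_of_periodic (periodize_add_latPt hq f)
    ((hf _ hz).congr_of_eventuallyEq (periodize_eventuallyEq f (hA hz)))

end Periodic

/-! ### Periodic cutoff functions -/

section Cutoffs

variable (𝕜 : Type*) [RCLike 𝕜] {n : ℕ} {q : Fin n → ℝ}

open scoped Manifold in
-- A smooth Urysohn function for `A` and the complement of `W`, periodized. Its support is a compact
-- subset of the open cell, so it stays away from the faces and no smoothness is lost. The bound on
-- `1 - θ` serves the exterior cutoff.
lemma exists_periodic_bump (hq : ∀ j, 0 < q j) {A W : Set (Euc n)} (hA : IsClosed A)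
    (hW : IsOpen W) (hAW : A ⊆ W) (hWq : W ⊆ cell q) :
    ∃ θ : Euc n → 𝕜, ContDiff ℝ ∞ θ ∧ (∀ x z, θ (x + latPt q z) = θ x) ∧
      (∀ y ∈ A, θ =ᶠ[𝓝 y] 1) ∧ tsupport θ ⊆ perSet q W ∧ ∀ y, ‖θ y‖ ≤ 1 ∧ ‖1 - θ y‖ ≤ 1 := by
  obtain ⟨f, hf0, hf1, hf⟩ := exists_contMDiffMap_zero_one_nhds_of_isClosed (n := ⊤)
    𝓘(ℝ, Euc n) hW.isClosed_compl hA (disjoint_left.2 fun x hx hx' => hx (hAW hx'))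
  have hsm : ContDiff ℝ ∞ f := f.contMDiff.contDiff
  set g : Euc n → 𝕜 := fun x => ((f x : ℝ) : 𝕜) with hg
  have hgs : ContDiff ℝ ∞ g := (RCLike.ofRealCLM (K := 𝕜)).contDiff.comp hsm
  have hgW : tsupport g ⊆ W := by
    intro x hx
    by_contra hxW
    refine notMem_tsupport_iff_eventuallyEq.2 ?_ hx
    filter_upwards [eventually_nhdsSet_iff_forall.1 hf0 x hxW] with y hy
    simp [hg, hy]
  have hgc : IsCompact (tsupport g) := Metric.isCompact_of_isClosed_isBounded (isClosed_tsupport g)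
    (isBounded_cell.subset (hgW.trans hWq))
  have hts := tsupport_periodize_subset (q := q) hgc hW hgW
  refine ⟨periodize q g, ?_, periodize_add_latPt hq g, fun y hy => ?_, hts, fun y => ?_⟩
  · refine contDiff_iff_contDiffAt.2 fun x => ?_
    by_cases hx : x ∈ tsupport (periodize q g)
    · exact contDiffAt_periodize hq hWq (fun x _ => hgs.contDiffAt) x (hts hx)
    · exact (contDiffAt_const (c := (0 : 𝕜))).congr_of_eventuallyEq
        (notMem_tsupport_iff_eventuallyEq.1 hx)
  · refine (periodize_eventuallyEq g (hWq (hAW hy))).trans ?_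
    filter_upwards [eventually_nhdsSet_iff_forall.1 hf1 y hy] with x hx
    simp [hg, hx]
  · obtain ⟨h0, h1⟩ := hf (y + latPt q fun j => -⌊y j / q j⌋)
    simp only [periodize, hg]
    rw [show (1 : 𝕜) = ((1 : ℝ) : 𝕜) by simp, ← RCLike.ofReal_sub, RCLike.norm_ofReal,
      RCLike.norm_ofReal, abs_of_nonneg h0, abs_of_nonneg (sub_nonneg.2 h1)]
    exact ⟨h1, by linarith⟩

lemma exists_cutoff_perSet (hq : ∀ j, 0 < q j) {Ω : Set (Euc n)} (hΩ : IsOpen Ω)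
    (hΩq : closure Ω ⊆ cell q) {δ : ℝ} (hδ : 0 < δ) :
    ∃ χ : Euc n → 𝕜, IsCutoff q (perSet q Ω) (Metric.cthickening δ (frontier Ω)) χ := by
  -- The bump is 1 near this closed set, which contains all points of `Ω` outside the closed
  -- `δ`-neighbourhood of the boundary.
  have hA : closure Ω \ Metric.thickening δ (frontier Ω) ⊆ Ω := by
    rintro x ⟨hx, hx'⟩
    by_contra h
    exact hx' (Metric.self_subset_thickening hδ _ (by
      rw [hΩ.frontier_eq]; exact ⟨hx, h⟩))
  obtain ⟨θ, h1, h2, h3, h4, h5⟩ := exists_periodic_bump 𝕜 hq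
    (isClosed_closure.sdiff Metric.isOpen_thickening) hΩ hA (subset_closure.trans hΩq)
  refine ⟨θ, h1, h2, h4, fun y hy hyN => h3 y ⟨?_, fun h => hyN ?_⟩, fun y => (h5 y).1⟩
  · rw [perSet_inter_cell (subset_closure.trans hΩq)] at hy
    exact subset_closure hy
  · exact Metric.thickening_subset_cthickening _ _ h

/-- The cutoff is `1 - θ`, where the bump `θ` is 1 near `closure Ω` and is supported in the
translates of the part of `Ω ∪ thickening δ (frontier Ω)` inside the cell. -/
lemma exists_cutoff_perSetExt (hq : ∀ j, 0 < q j) {Ω : Set (Euc n)} (hΩ : IsOpen Ω)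
    (hΩq : closure Ω ⊆ cell q) {δ : ℝ} (hδ : 0 < δ) :
    ∃ χ : Euc n → 𝕜, IsCutoff q (perSetExt q Ω) (Metric.cthickening δ (frontier Ω)) χ := by
  have hW : IsOpen (cell q ∩ (Ω ∪ Metric.thickening δ (frontier Ω))) :=
    isOpen_cell.inter (hΩ.union Metric.isOpen_thickening)
  have hAW : closure Ω ⊆ cell q ∩ (Ω ∪ Metric.thickening δ (frontier Ω)) := fun x hx => by
    refine ⟨hΩq hx, ?_⟩
    by_cases h : x ∈ Ω
    · exact Or.inl h
    · exact Or.inr (Metric.self_subset_thickening hδ _ (by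
        rw [hΩ.frontier_eq]; exact ⟨hx, h⟩))
  obtain ⟨θ, h1, h2, h3, h4, h5⟩ := exists_periodic_bump 𝕜 hq isClosed_closure hW hAW
    inter_subset_left
  refine ⟨1 - θ, contDiff_const.sub h1, fun x z => by simp [h2], ?_, fun y hy hyN => ?_,
    fun y => (h5 y).2⟩
  · intro x hx hx'
    have hcomp : IsCompact (closure Ω) :=
      Metric.isCompact_of_isClosed_isBounded isClosed_closure (isBounded_cell.subset hΩq)
    -- This set is open, so its translates cover even the closure of the periodic set, and `1 - θ`
    -- vanishes near every point there.
    have hV : closure Ω ⊆ {y | ∀ᶠ t in 𝓝 y, θ t = 1} := h3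
    obtain ⟨z, hz⟩ := mem_perSet_iff.1
      (closure_perSet_subset (q := q) hcomp isOpen_setOfPred_eventually_nhds hV hx')
    refine notMem_tsupport_iff_eventuallyEq.2 ?_ hx
    filter_upwards [eventually_add_latPt z hz] with y hy
    rw [h2] at hy
    simp [hy]
  · have hyt : y ∉ tsupport θ := fun h => by
      have h6 : y ∈ perSet q (cell q ∩ (Ω ∪ Metric.thickening δ (frontier Ω))) ∩ cell q :=
        ⟨h4 h, hy.2⟩
      rw [perSet_inter_cell inter_subset_left] at h6
      rcases h6.2 with h7 | h7
      · exact hy.1 (subset_closure (subset_perSet q Ω h7))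
      · exact hyN (Metric.thickening_subset_cthickening _ _ h7)
    filter_upwards [notMem_tsupport_iff_eventuallyEq.1 hyt] with t ht
    simp [ht]

/-- The set of differences is compact, hence has a closed `ε`-neighbourhood inside `G`; moving both
points by at most `ε / 2` stays in it. -/
lemma exists_thickenings_sub_subset {K F G : Set (Euc n)} (hK : IsCompact K) (hF : IsCompact F)
    (hG : IsOpen G) (h : {w : Euc n | ∃ t ∈ K, ∃ s ∈ F, w = t - s} ⊆ G) :
    ∃ δ > 0, ∃ C : Set (Euc n), IsCompact C ∧ C ⊆ G ∧
      ∀ x ∈ Metric.thickening δ K, ∀ y ∈ Metric.cthickening δ F, x - y ∈ C := by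
  have hKF : IsCompact {w : Euc n | ∃ t ∈ K, ∃ s ∈ F, w = t - s} := by
    have : {w : Euc n | ∃ t ∈ K, ∃ s ∈ F, w = t - s} = (fun p : Euc n × Euc n => p.1 - p.2) ''
        (K ×ˢ F) := by
      ext w
      simp only [mem_ofPred_eq, mem_image, mem_prod, Prod.exists]
      constructor
      · rintro ⟨t, ht, s, hs, rfl⟩; exact ⟨t, s, ⟨ht, hs⟩, rfl⟩
      · rintro ⟨t, s, ⟨ht, hs⟩, rfl⟩; exact ⟨t, ht, s, hs, rfl⟩
    rw [this]
    exact (hK.prod hF).image (by fun_prop)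
  obtain ⟨ε, hε, hεG⟩ := hKF.exists_cthickening_subset_open hG h
  refine ⟨ε / 2, half_pos hε, _, hKF.cthickening (r := ε), hεG, fun x hx y hy => ?_⟩
  obtain ⟨t, ht, htx⟩ := Metric.mem_thickening_iff.1 hx
  rw [hF.cthickening_eq_biUnion_closedBall (half_pos hε).le] at hy
  obtain ⟨s, hs, hsy⟩ := mem_iUnion₂.1 hy
  refine Metric.mem_cthickening_of_dist_le _ (t - s) _ _ ⟨t, ht, s, hs, rfl⟩ ?_
  have := dist_sub_sub_le x y t s
  rw [Metric.mem_closedBall] at hsy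
  linarith

end Cutoffs


/-! ### The potentials as continuous bilinear maps -/

section Assembly

variable {𝕜 : Type*} [RCLike 𝕜] {n : ℕ} {q : Fin n → ℝ} {ρ lam : ℝ}

/-- A periodic function which is smooth near the closure of a periodic set defines an element of
the periodic Roumieu class of this set. -/
lemma indicator_mem_perRoumieu (hρ : 0 < ρ) {Ω₁ U : Set (Euc n)} (hΩ₁ : IsOpen Ω₁)
    (hc : IsCompact (closure Ω₁)) (hU : IsOpen U) (hΩ₁U : closure Ω₁ ⊆ U) {p : Euc n → 𝕜}
    (hp : ∀ x z, p (x + latPt q z) = p x) (hs : ContDiffOn ℝ ∞ p U) {M : ℝ}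
    (hM : ∀ (L : List (Fin n)), ∀ x ∈ U,
      ‖L.foldr partialD p x‖ ≤ M * (L.length.factorial / ρ ^ L.length)) :
    (closure (perSet q Ω₁)).indicator p ∈
        roumieuSubmodule 𝕜 ρ (perSet q Ω₁) Ω₁ (subset_perSet q Ω₁) ⊓
          periodicSubmodule 𝕜 q (closure (perSet q Ω₁)) ∧
      roumieuENorm ρ Ω₁ ((closure (perSet q Ω₁)).indicator p) ≤ ENNReal.ofReal M := by
  have hcl := closure_perSet_subset (q := q) hc hU hΩ₁U
  have hsm : ∀ x ∈ closure (perSet q Ω₁), ContDiffAt ℝ ∞ p x := fun x hx => by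
    obtain ⟨z, hz⟩ := mem_perSet_iff.1 (hcl hx)
    exact contDiffAt_of_periodic hp ((hs _ hz).contDiffAt (hU.mem_nhds hz))
  have hev : ∀ x ∈ perSet q Ω₁, (closure (perSet q Ω₁)).indicator p =ᶠ[𝓝 x] p := fun x hx => by
    filter_upwards [(isOpen_perSet hΩ₁).mem_nhds hx] with y hy
    exact indicator_of_mem (subset_closure hy) p
  have hnorm : roumieuENorm ρ Ω₁ ((closure (perSet q Ω₁)).indicator p) ≤ ENNReal.ofReal M := by
    refine roumieuENorm_le hρ fun β x hx => ?_
    rw [multiD, (foldr_congr (multiList β) (hev x (subset_perSet q Ω₁ hx))).self_of_nhds,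
      ← length_multiList]
    exact hM _ x (hΩ₁U (subset_closure hx))
  refine ⟨⟨⟨fun x hx => indicator_of_notMem hx p, ⟨fun x hx => ?_, ?_, fun β => ?_⟩,
    hnorm.trans_lt ENNReal.ofReal_lt_top⟩, fun x hx z => ?_⟩, hnorm⟩
  · exact (hsm x (subset_closure hx)).congr_of_eventuallyEq (hev x hx)
  · refine ContinuousOn.congr (f := p) (fun x hx => (hsm x hx).continuousAt.continuousWithinAt)
      fun x hx => indicator_of_mem hx p
  · refine ⟨multiD β p, fun x hx =>
      (contDiffAt_foldr (multiList β) (hsm x hx)).continuousAt.continuousWithinAt, fun x hx => ?_⟩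
    exact (foldr_congr (multiList β) (hev x hx)).self_of_nhds.symm
  · rw [indicator_of_mem hx, indicator_of_mem (add_latPt_mem_closure_perSet hx z), hp]

variable {G : Set (Euc n)}

lemma hKernel_periodic (h : HKernel 𝕜 q lam ρ G) (x : Euc n) (z : Fin n → ℤ) :
    h (x + latPt q z) = h x := kernel_periodic h.2.1 h.2.2.2.1 x z

variable [hq : Fact (∀ j, 0 < q j)]

lemma hKernel_integrable (hn : 0 < n) (hlam : lam < n) (h : HKernel 𝕜 q lam ρ G) :
    IntegrableOn h (cell q) ∧
      ∫ x in cell q, ‖h x‖ ≤ ‖h‖ * ∫ x in centeredCell q, ‖x‖ ^ (-lam) := by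
  have hw : weightENorm q lam h.1 ≤ kernelENorm q lam h.1 := le_self_add
  have h1 := integrableOn_kernel hq.out hn hlam h.2.1 h.2.2.1 h.2.2.2.1
    (hw.trans_lt h.2.2.2.2.1)
  refine ⟨h1.1, h1.2.trans (mul_le_mul_of_nonneg_right ?_ ?_)⟩
  · exact (ENNReal.toReal_mono h.2.2.2.2.1.ne hw).trans
      (le_add_of_nonneg_right ENNReal.toReal_nonneg)
  · exact integral_nonneg fun x => by positivity

variable {X : Type*} [NormedAddCommGroup X] [NormedSpace 𝕜 X]

/-- Absolute convergence makes the integral additive in each argument, and the bounds on all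
derivatives are exactly a bound on the norm of the target. -/
lemma exists_bilinear_potential (hρ : 0 < ρ) {Ω₁ U D : Set (Euc n)} (hΩ₁ : IsOpen Ω₁)
    (hc : IsCompact (closure Ω₁)) (hU : IsOpen U) (hΩ₁U : closure Ω₁ ⊆ U)
    (ev : X →ₗ[𝕜] (Euc n → 𝕜))
    (hi : ∀ (h : HKernel 𝕜 q lam ρ G) (φ : X) (x : Euc n),
      IntegrableOn (fun y => h (x - y) * ev φ y) D)
    (hs : ∀ (h : HKernel 𝕜 q lam ρ G) (φ : X),
      ContDiffOn ℝ ∞ (fun x => ∫ y in D, h (x - y) * ev φ y) U) {M : ℝ}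
    (hM : ∀ (h : HKernel 𝕜 q lam ρ G) (φ : X) (L : List (Fin n)), ∀ x ∈ U,
      ‖L.foldr partialD (fun x => ∫ y in D, h (x - y) * ev φ y) x‖ ≤
        M * ‖h‖ * ‖φ‖ * (L.length.factorial / ρ ^ L.length)) :
    ∃ B : HKernel 𝕜 q lam ρ G →L[𝕜] X →L[𝕜] PerRoumieu 𝕜 q ρ Ω₁,
      ∀ (h : HKernel 𝕜 q lam ρ G) (φ : X), ∀ x ∈ closure (perSet q Ω₁),
        B h φ x = ∫ y in D, h (x - y) * ev φ y := by
  have hmem := fun h φ => indicator_mem_perRoumieu (q := q) hρ hΩ₁ hc hU hΩ₁U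
    (p := fun x => ∫ y in D, h (x - y) * ev φ y)
    (fun x z => by simp only [add_sub_right_comm, hKernel_periodic h]) (hs h φ) (hM h φ)
  let F : HKernel 𝕜 q lam ρ G → X → PerRoumieu 𝕜 q ρ Ω₁ := fun h φ => ⟨_, (hmem h φ).1⟩
  have hF : ∀ h φ, (F h φ).1 = (closure (perSet q Ω₁)).indicator
    fun x => ∫ y in D, h (x - y) * ev φ y := fun _ _ => rfl
  let B₀ : HKernel 𝕜 q lam ρ G →ₗ[𝕜] X →ₗ[𝕜] PerRoumieu 𝕜 q ρ Ω₁ := by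
    refine LinearMap.mk₂ 𝕜 F ?_ ?_ ?_ ?_
    · intro h h' φ
      refine Subtype.ext ?_
      change (F (h + h') φ).1 = (F h φ).1 + (F h' φ).1
      rw [hF, hF, hF, ← indicator_add']
      congr 1
      funext x
      rw [Pi.add_apply, ← integral_add (hi h φ x) (hi h' φ x)]
      exact integral_congr_ae (Eventually.of_forall fun y => add_mul _ _ _)
    · intro c h φ
      refine Subtype.ext ?_
      change (F (c • h) φ).1 = c • (F h φ).1
      rw [hF, hF]
      refine Eq.trans ?_ (indicator_const_smul _ c _)
      congr 1
      funext x
      rw [← integral_smul]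
      exact integral_congr_ae (Eventually.of_forall fun y => smul_mul_assoc c _ _)
    · intro h φ φ'
      refine Subtype.ext ?_
      change (F h (φ + φ')).1 = (F h φ).1 + (F h φ').1
      rw [hF, hF, hF, ← indicator_add']
      congr 1
      funext x
      rw [Pi.add_apply, ← integral_add (hi h φ x) (hi h φ' x)]
      exact integral_congr_ae (Eventually.of_forall fun y => by simp [mul_add])
    · intro c h φ
      refine Subtype.ext ?_
      change (F h (c • φ)).1 = c • (F h φ).1
      rw [hF, hF]
      refine Eq.trans ?_ (indicator_const_smul _ c _)
      congr 1
      funext x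
      rw [← integral_smul]
      exact integral_congr_ae (Eventually.of_forall fun y => by simp [mul_left_comm])
  -- The sign of `M` is not known, and a nonnegative bound is needed to pass from the extended norm
  -- to the real one.
  refine ⟨B₀.mkContinuous₂ (max M 0) fun h φ => ?_, fun h φ x hx => ?_⟩
  · have h0 : 0 ≤ max M 0 * ‖h‖ * ‖φ‖ := by positivity
    refine (ENNReal.toReal_le_of_le_ofReal h0 ((hmem h φ).2.trans
      (ENNReal.ofReal_le_ofReal ?_)))
    gcongr
    exact le_max_left _ _
  · change (F h φ).1 x = _
    rw [hF]
    exact indicator_of_mem hx _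

/-- The common part of the two potentials: `S` is a periodic open set and `rep φ` is a periodic
smooth function on `S` which represents the density `ev φ` on `S ∩ Q`. -/
lemma exists_bilinear_of_cutoff (hn : 0 < n) (hlam : lam < n) (hρ : 0 < ρ)
    {Ω₁ U C N S : Set (Euc n)} (hΩ₁ : IsOpen Ω₁) (hc : IsCompact (closure Ω₁)) (hU : IsOpen U)
    (hΩ₁U : closure Ω₁ ⊆ U) (hC : IsCompact C) (hCG : C ⊆ G) (hN : MeasurableSet N)
    (hS : IsOpen S) (hsub : ∀ x ∈ U, ∀ y ∈ N, x - y ∈ C) {χ : Euc n → 𝕜} (hχ : IsCutoff q S N χ)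
    (ev : X →ₗ[𝕜] (Euc n → 𝕜)) (rep : X → Euc n → 𝕜)
    (hrep : ∀ φ, ∀ y ∈ S ∩ cell q, rep φ y = ev φ y)
    (hrs : ∀ φ, ∀ y ∈ S, ContDiffAt ℝ ∞ (rep φ) y) (hrp : ∀ φ, PeriodicOn q S (rep φ))
    (hrb : ∀ φ, ∀ L : List (Fin n), ∀ y ∈ S ∩ cell q,
      ‖L.foldr partialD (rep φ) y‖ ≤ ‖φ‖ * (L.length.factorial / ρ ^ L.length)) :
    (∀ (h : HKernel 𝕜 q lam ρ G) (φ : X) (x : Euc n),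
      IntegrableOn (fun y => h (x - y) * ev φ y) (S ∩ cell q)) ∧
    ∃ B : HKernel 𝕜 q lam ρ G →L[𝕜] X →L[𝕜] PerRoumieu 𝕜 q ρ Ω₁,
      ∀ (h : HKernel 𝕜 q lam ρ G) (φ : X), ∀ x ∈ closure (perSet q Ω₁),
        B h φ x = ∫ y in S ∩ cell q, h (x - y) * ev φ y := by
  have hD : MeasurableSet (S ∩ cell q) := hS.measurableSet.inter isOpen_cell.measurableSet
  have d : ∀ (h : HKernel 𝕜 q lam ρ G) (φ : X),
      PotentialData q S N U C ρ ‖φ‖ ‖h‖ χ (rep φ) h.1 := fun h φ =>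
    { pos := hq.out
      rho_pos := hρ
      density_bound_nonneg := norm_nonneg _
      kernel_bound_nonneg := norm_nonneg _
      isOpen_S := hS
      measurableSet_N := hN
      isOpen_U := hU
      isCompact_C := hC
      sub_mem := fun x hx y hy => hsub x hx y hy.2
      cutoff := hχ
      density_smooth := hrs φ
      density_periodic := hrp φ
      density_bound := hrb φ
      kernel_integrable := (hKernel_integrable hn hlam h).1
      kernel_periodic := hKernel_periodic h
      kernel_smooth := fun x hx => h.2.2.2.2.2.1.contDiffAt x (hCG hx)
      kernel_bound := fun L x hx => by
        refine (norm_foldr_le_of_roumieuENorm hρ h.2.2.2.2.2.2 L (hCG hx)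
          (h.2.2.2.2.2.1.contDiffAt x (hCG hx))).trans ?_
        gcongr
        exact le_add_of_nonneg_left ENNReal.toReal_nonneg }
  have hint : ∀ (h : HKernel 𝕜 q lam ρ G) (φ : X) (x : Euc n),
      ∫ y in S ∩ cell q, h (x - y) * ev φ y = ∫ y in S ∩ cell q, h (x - y) * rep φ y :=
    fun h φ x => setIntegral_congr_fun hD fun y hy => by simp only [hrep φ y hy]
  have hi : ∀ (h : HKernel 𝕜 q lam ρ G) (φ : X) (x : Euc n),
      IntegrableOn (fun y => h (x - y) * ev φ y) (S ∩ cell q) := fun h φ x =>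
    ((d h φ).integrableOn_potential x).congr_fun (fun y hy => by simp only [hrep φ y hy]) hD
  -- One constant for all directions; it depends on the cutoff only, not on `h` or `φ`.
  have hbd : ∃ c, 0 ≤ c ∧ ∀ j, ∀ y ∈ cell q, ‖partialD j χ y‖ ≤ c := by
    choose c hc using fun j => exists_bound_on_cell (q := q)
      (contDiff_partialD hχ.contDiff j).continuous
    refine ⟨∑ j, max (c j) 0, by positivity, fun j y hy => ?_⟩
    exact ((hc j y hy).trans (le_max_left _ _)).trans
      (Finset.single_le_sum (f := fun j => max (c j) 0) (fun _ _ => le_max_right _ _)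
        (Finset.mem_univ j))
  obtain ⟨c, hc0, hcb⟩ := hbd
  refine ⟨hi, exists_bilinear_potential hρ hΩ₁ hc hU hΩ₁U ev hi (fun h φ => ?_)
    (M := (∫ x in centeredCell q, ‖x‖ ^ (-lam)) + 2 * volume.real (cell q) +
      ρ * c * volume.real (cell q)) fun h φ L x hx => ?_⟩
  · simp only [hint]
    exact (d h φ).contDiffOn_potential
  · simp only [hint]
    refine ((d h φ).norm_foldr_potential_le hc0 hcb L hx).trans ?_
    have h1 := (hKernel_integrable hn hlam h).2
    gcongr
    calc _ ≤ (‖h‖ * ∫ x in centeredCell q, ‖x‖ ^ (-lam)) * ‖φ‖ +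
          2 * volume.real (cell q) * (‖h‖ * ‖φ‖) +
          ρ * c * volume.real (cell q) * (‖h‖ * ‖φ‖) := by gcongr
      _ = _ := by ring

end Assembly

end PeriodicPotential

/-! ### The two continuity statements -/

open PeriodicPotential
theorem theorem3p8 {𝕜 : Type*} [RCLike 𝕜] {n : ℕ} (hn : 2 ≤ n)
    (q : Fin n → ℝ) [hq : Fact (∀ j, 0 < q j)]
    (ρ lam : ℝ) (hρ : 0 < ρ) (hlam : 0 < lam) (hlam' : lam < (n : ℝ) - 1)
    (Ω Ω₁ G : Set (Euc n))
    (hΩ : IsBoundedLipschitz Ω) (hΩQ : closure Ω ⊆ cell q)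
    (hΩ₁ : IsOpen Ω₁) (hΩ₁ne : Ω₁.Nonempty) (hΩ₁Ω : closure Ω₁ ⊆ Ω)
    (hG : IsOpen G) (hGb : IsCompact (closure G))
    (hGnhds : {w : Euc n | ∃ t ∈ closure Ω₁, ∃ s ∈ frontier Ω, w = t - s} ⊆ G)
    (hGq : closure G ∩ lattice q = ∅) :
    ((∀ (h : HKernel 𝕜 q lam ρ G) (φ : Roumieu 𝕜 ρ Ω) (x : Euc n),
        IntegrableOn (fun y => h (x - y) * φ y) Ω) ∧
      ∃ B : HKernel 𝕜 q lam ρ G →L[𝕜] Roumieu 𝕜 ρ Ω →L[𝕜] PerRoumieu 𝕜 q ρ Ω₁,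
        ∀ (h : HKernel 𝕜 q lam ρ G) (φ : Roumieu 𝕜 ρ Ω), ∀ x ∈ closure (perSet q Ω₁),
          B h φ x = potentialInt Ω h φ x) ∧
    ((∀ (h : HKernel 𝕜 q lam ρ G) (φ : PerRoumieuExt 𝕜 q ρ Ω) (x : Euc n),
        IntegrableOn (fun y => h (x - y) * φ y) (cell q \ closure Ω)) ∧
      ∃ B : HKernel 𝕜 q lam ρ G →L[𝕜] PerRoumieuExt 𝕜 q ρ Ω →L[𝕜] PerRoumieu 𝕜 q ρ Ω₁,
        ∀ (h : HKernel 𝕜 q lam ρ G) (φ : PerRoumieuExt 𝕜 q ρ Ω), ∀ x ∈ closure (perSet q Ω₁),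
          B h φ x = potentialExt q Ω h φ x) := by
  have hΩq : Ω ⊆ cell q := subset_closure.trans hΩQ
  have hcΩ : IsCompact (closure Ω) := hΩ.isBounded.isCompact_closure
  have hc : IsCompact (closure Ω₁) :=
    (hΩ.isBounded.subset (subset_closure.trans hΩ₁Ω)).isCompact_closure
  have hF : IsCompact (frontier Ω) := hcΩ.of_isClosed_subset isClosed_frontier
    frontier_subset_closure
  have hn0 : 0 < n := by omega
  have hlamn : lam < n := by linarith
  -- One `δ` serves both statements: `U` is the open `δ`-neighbourhood of `cl Ω₁` and `N` the closed
  -- `δ`-neighbourhood of `∂Ω`.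
  obtain ⟨δ, hδ, C, hC, hCG, hsub⟩ := exists_thickenings_sub_subset hc hF hG hGnhds
  have hN : MeasurableSet (Metric.cthickening δ (frontier Ω)) :=
    Metric.isClosed_cthickening.measurableSet
  have hΩ₁U := Metric.self_subset_thickening hδ (closure Ω₁)
  constructor
  · obtain ⟨χ, hχ⟩ := exists_cutoff_perSet 𝕜 hq.out hΩ.isOpen hΩQ hδ
    -- Here `S = 𝕊[Ω]`, with `S ∩ Q = Ω`. The density lives on `cl Ω` only, so its periodization
    -- represents it.
    have h := exists_bilinear_of_cutoff (lam := lam) hn0 hlamn hρ hΩ₁ hc Metric.isOpen_thickening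
      hΩ₁U hC hCG hN (isOpen_perSet hΩ.isOpen) hsub hχ
      (X := Roumieu 𝕜 ρ Ω) (roumieuSubmodule 𝕜 ρ Ω Ω subset_rfl).subtype
      (fun φ => periodize q φ) (fun φ y hy => periodize_of_mem_cell _ hy.2)
      (fun φ => contDiffAt_periodize hq.out hΩq φ.2.2.1.contDiffAt)
      (fun φ x _ z => periodize_add_latPt hq.out _ x z) (fun φ L y hy => by
        rw [perSet_inter_cell hΩq] at hy
        rw [(foldr_congr L (periodize_eventuallyEq φ.1 (hΩq hy))).self_of_nhds]
        exact norm_foldr_le_of_roumieuENorm hρ φ.2.2.2 L hy (φ.2.2.1.contDiffAt y hy))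
    rw [perSet_inter_cell hΩq] at h
    exact h
  · obtain ⟨χ, hχ⟩ := exists_cutoff_perSetExt 𝕜 hq.out hΩ.isOpen hΩQ hδ
    have hS : IsOpen (perSetExt q Ω) := isClosed_closure.isOpen_compl
    -- Here `S = 𝕊[Ω]⁻`, with `S ∩ Q = Q \ cl Ω`. The density is already periodic on `S` and
    -- represents itself.
    have h := exists_bilinear_of_cutoff (lam := lam) hn0 hlamn hρ hΩ₁ hc Metric.isOpen_thickening
      hΩ₁U hC hCG hN hS hsub hχ
      (X := PerRoumieuExt 𝕜 q ρ Ω) (roumieuSubmodule 𝕜 ρ (perSetExt q Ω)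
        (perSetExt q Ω ∩ closure (cell q)) inter_subset_left ⊓
        periodicSubmodule 𝕜 q (closure (perSetExt q Ω))).subtype
      (fun φ => φ) (fun φ y hy => rfl) (fun φ => φ.2.1.2.1.contDiffAt)
      (fun φ x hx z => φ.2.2 x (subset_closure hx) z) (fun φ L y hy =>
        norm_foldr_le_of_roumieuENorm hρ φ.2.1.2.2 L ⟨hy.1, subset_closure hy.2⟩
          (φ.2.1.2.1.contDiffAt y hy.1))
    rw [perSetExt_inter_cell hΩq] at h
    exact h
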